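/- Let $K\subset\mathbb R^2$ be a convex body (compact, convex) containing the origin $o$ in its interior. For a set $L\subset\mathbb R^2$ and $\theta\in\mathbb R$, let $\mathcal F_o(L)=\bigcup_{s\in L}B_{\frac12\|s\|}(\tfrac12 s)$ be its Voronoi flower with respect to $o$ ($B_r(x)$ is the closed disk with centre $x$ and radius $r$), let $p_o(L,\theta)=\sup_{y\in L}\langle y,u_\theta\rangle$, $u_\theta=(\cos\theta,\sin\theta)$, be its support function, and let $\mathcal A(L)$ be its area. For $\lambda>0$ let $\mathcal P_\lambda$ be a homogeneous Poisson point process of intensity $\lambda$ in $\mathbb R^2$, and let $$K_\lambda=\{y\in\mathbb R^2:\ \|y\|\le\|y-x\|\ \text{ for all } x\in\mathcal P_\lambda\setminus 2\mathcal F_o(K)\}$$ be the Voronoi cell of the nucleus $o$ for the set of nuclei $(\mathcal P_\lambda\setminus 2\mathcal F_o(K))\cup\{o\}$. Let $\mathcal N(K_\lambda)$ be the number of vertices of $K_\lambda$. Then the expectations below are finite, and: (i) for every $\lambda>0$, $$\mathbb E\,\mathcal N(K_\lambda)=4\lambda\bigl(\mathbb E\,\mathcal A(\mathcal F_o(K_\lambda))-\mathcal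 A(\mathcal F_o(K))\bigr);$$ (ii) as $\lambda\to\infty$, $$\mathbb E\,\mathcal N(K_\lambda)\sim 4\lambda\int_0^{2\pi}p_o(K,\theta)\,\mathbb E\bigl(p_o(K_\lambda,\theta)-p_o(K,\theta)\bigr)\,d\theta,$$ that is, the ratio of the two sides tends to $1$. -/

import Mathlib

open MeasureTheory ProbabilityTheory Filter Topology
open scoped Pointwise

noncomputable section

namespace PoissonVoronoi

/-- The Euclidean plane. -/
abbrev Plane : Type := EuclideanSpace ℝ (Fin 2)

/-- `X : Ω → Set Plane` is a homogeneous Poisson point process of intensity `l` on the plane: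
a random locally finite set whose numbers of points in bounded Borel sets `B` are random variables
with the Poisson law of mean `l * area B`, independent for pairwise disjoint sets. -/
structure IsPoissonProcess {Ω : Type*} [MeasurableSpace Ω] (P : Measure Ω) (l : ℝ)
    (X : Ω → Set Plane) : Prop where
  locallyFinite : ∀ ω, ∀ B : Set Plane, Bornology.IsBounded B → (X ω ∩ B).Finite
  measurable_count : ∀ B : Set Plane, MeasurableSet B → Bornology.IsBounded B →
    Measurable fun ω => (X ω ∩ B).ncard
  map_count : ∀ B : Set Plane, MeasurableSet B → Bornology.IsBounded B →
    P.map (fun ω => (X ω ∩ B).ncard) = poissonMeasure (l * volume.real B).toNNReal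
  indep_count : ∀ (n : ℕ) (B : Fin n → Set Plane), (∀ i, MeasurableSet (B i)) →
    (∀ i, Bornology.IsBounded (B i)) → Pairwise (fun i j => Disjoint (B i) (B j)) →
    iIndepFun (fun i ω => (X ω ∩ B i).ncard) P

/-- The Voronoi cell of the nucleus `x` for the set of nuclei `S`. -/
def voronoiCell (S : Set Plane) (x : Plane) : Set Plane :=
  {y | ∀ x' ∈ S, ‖y - x‖ ≤ ‖y - x'‖}

/-- The Voronoi flower of `L` with respect to `x`: the union of the closed disks having a
segment `[x, s]`, `s ∈ L`, as a diameter. -/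
def flower (x : Plane) (L : Set Plane) : Set Plane :=
  ⋃ s ∈ L, Metric.closedBall ((1 / 2 : ℝ) • (s + x)) (1 / 2 * ‖s - x‖)

/-- The support function of `L` with respect to `x`. -/
def supportFun (x : Plane) (L : Set Plane) (z : Plane) : ℝ :=
  sSup ((fun y : Plane => inner ℝ (y - x) z) '' L)

/-- The unit vector `(cos θ, sin θ)`. -/
def unitVec (θ : ℝ) : Plane := !₂[Real.cos θ, Real.sin θ]

/-- The area of a subset of the plane. -/
def area (L : Set Plane) : ℝ := volume.real L

/-- The number of vertices of a convex polygon: the number of its extreme points. -/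
def numVertices (L : Set Plane) : ℕ := (L.extremePoints ℝ).ncard

/-- For the set `K` and the configuration `χ`, the Voronoi cell of the nucleus `0` for the nuclei
`0` and the points of `χ` that lie outside twice the Voronoi flower of `K`. -/
def cellAround (K χ : Set Plane) : Set Plane :=
  voronoiCell ((χ ∩ ((2 : ℝ) • flower 0 K)ᶜ) ∪ {0}) 0

end PoissonVoronoi

end

noncomputable section

namespace PoissonVoronoi

/-! ### Convex polygons: vertices and edges -/

/-! A point `y` lies in the cell exactly when the open disk about `y` through the origin contains no
nucleus outside `2 F(K)`, with `F` the flower. Call that disk minus `2 F(K)` the test set of `y`. A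
bounded polygon has as many vertices as edges (`ncard_extremePoints_polygon`), and an edge
corresponds to a nucleus `x` that is the only one in some test set. By contrast, the union of the
test sets without any nucleus is `2 F(K_λ) \ 2 F(K)` up to a null set, and its area is `4 (A(F(K_λ))
- A(F(K)))`.

Part (i) is therefore a Mecke formula: the expected number of points that are alone in some test set
equals `λ` times the expected area covered by the empty test sets. Centres from a dense sequence
suffice. For finitely many test sets the formula is proved on the atoms they generate: counts in
distinct atoms are independent, and a Poisson variable of mean `m` satisfies `P(1) = m P(0)`
(`IsPoissonProcess.finite_mecke`). Monotone convergence gives the countable case.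

For part (ii), polar coordinates give `A(F(L)) = ½ ∫ p_L²`. With `d = p(K_λ) - p(K) ≥ 0`, part (i)
becomes `E N = 4λ D + 2λ S`, where `D = ∫ p(K) E d` and `S = ∫ E d²`. Outside an exceptional event
`K_λ ⊆ (1 + ε) K`, hence `d² ≤ ε p(K) d`; the exceptional part contributes `O(λ⁻²)` because a cell
that leaves a large multiple of `K` forces one of finitely many large disks to be empty
(`exists_envelope`). So `S ≤ ε D + O(λ⁻²)`. No lower bound on `D` has to be computed: a compact
nonempty cell has a vertex, so `E N ≥ 1`, and this makes the error `O(1/λ)` negligible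
(`tendsto_one_of_expansion`). -/

theorem inner_eq (x y : Plane) : inner ℝ x y = x 0 * y 0 + x 1 * y 1 := by
  simp [PiLp.inner_apply, Fin.sum_univ_two, mul_comm]

/-- Rotation by a right angle. -/
def perp (v : Plane) : Plane := !₂[-v 1, v 0]

@[simp] theorem perp_zero (v : Plane) : perp v 0 = -v 1 := rfl

@[simp] theorem perp_one (v : Plane) : perp v 1 = v 0 := rfl

theorem plane_ext {x y : Plane} (h0 : x 0 = y 0) (h1 : x 1 = y 1) : x = y := by
  ext i; fin_cases i <;> assumption

theorem inner_perp_left (v : Plane) : inner ℝ (perp v) v = 0 := by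
  rw [inner_eq]; simp; ring

theorem normSq_pos {v : Plane} (hv : v ≠ 0) : 0 < v 0 ^ 2 + v 1 ^ 2 := by
  by_contra! h
  exact hv (plane_ext (by simp; nlinarith [sq_nonneg (v 0), sq_nonneg (v 1)])
    (by simp; nlinarith [sq_nonneg (v 0), sq_nonneg (v 1)]))

theorem perp_ne_zero {v : Plane} (hv : v ≠ 0) : perp v ≠ 0 := fun h => by
  have h0 := congrArg (fun z : Plane => z 0) h
  have h1 := congrArg (fun z : Plane => z 1) h
  simp at h0 h1
  exact hv (plane_ext h1 h0)

theorem exists_eq_smul_perp {v z : Plane} (hv : v ≠ 0) (h : inner ℝ z v = 0) :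
    ∃ t : ℝ, z = t • perp v := by
  have hp := normSq_pos hv
  rw [inner_eq] at h
  refine ⟨(z 1 * v 0 - z 0 * v 1) / (v 0 ^ 2 + v 1 ^ 2), plane_ext ?_ ?_⟩
  · simp only [PiLp.smul_apply, perp_zero, smul_eq_mul]
    field_simp
    linear_combination v 0 * h
  · simp only [PiLp.smul_apply, perp_one, smul_eq_mul]
    field_simp
    linear_combination v 1 * h

/-- The polygon cut out by the half-planes `⟨y, n⟩ ≤ 1`, `n ∈ A`. -/
def polygon (A : Finset Plane) : Set Plane := {y | ∀ n ∈ A, inner ℝ y n ≤ 1}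

/-- The normals in `A` whose removal enlarges the polygon. -/
def essentialNormals (A : Finset Plane) : Set Plane :=
  {n | n ∈ A ∧ ∃ y : Plane, 1 < inner ℝ y n ∧ ∀ m ∈ A, m ≠ n → inner ℝ y m ≤ 1}

theorem isClosed_polygon (A : Finset Plane) : IsClosed (polygon A) := by
  have : polygon A = ⋂ n ∈ A, {y | inner ℝ y n ≤ 1} := by ext; simp [polygon]
  rw [this]
  exact isClosed_biInter fun n _ => isClosed_le (by fun_prop) continuous_const

/-- Scaling the witness `y` down to the line of `n` gives a point strictly inside all other
half-planes. The line thus meets the bounded polygon in a nondegenerate segment, whose two ends are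
the vertices sought. -/
theorem essential_edge {A : Finset Plane} (hb : Bornology.IsBounded (polygon A)) {n : Plane}
    (hn : n ∈ essentialNormals A) :
    ∃ p q : Plane, p ≠ q ∧
      {v | v ∈ (polygon A).extremePoints ℝ ∧ inner ℝ v n = 1} = {p, q} := by
  obtain ⟨hnA, y, hy, hyA⟩ := hn
  have hn0 : n ≠ 0 := by rintro rfl; simp at hy; linarith
  set s : ℝ := (inner ℝ y n)⁻¹ with hs
  have hs0 : 0 < s := by positivity
  have hs1 : s < 1 := inv_lt_one_of_one_lt₀ hy
  set z : Plane := s • y with hz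
  have hzn : inner ℝ z n = 1 := by
    rw [hz, real_inner_smul_left, hs]; exact inv_mul_cancel₀ (by linarith)
  have hzm : ∀ m ∈ A, m ≠ n → inner ℝ z m < 1 := fun m hm hmn => by
    rw [hz, real_inner_smul_left]; nlinarith [hyA m hm hmn]
  set w := perp n with hw
  have hw0 : w ≠ 0 := perp_ne_zero hn0
  have hwn : inner ℝ w n = 0 := inner_perp_left n
  set T : Set ℝ := {t | z + t • w ∈ polygon A} with hT
  have hinj : ∀ a b : ℝ, z + a • w = z + b • w → a = b := fun a b h => by
    have h1 : a • w = b • w := add_left_cancel h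
    exact smul_left_injective ℝ hw0 h1
  have hline : ∀ t : ℝ, inner ℝ (z + t • w) n = 1 := fun t => by
    rw [inner_add_left, real_inner_smul_left w, hwn, hzn]; simp
  have hTn : T ∈ 𝓝 (0 : ℝ) := by
    have : ∀ᶠ t in 𝓝 (0 : ℝ), ∀ m ∈ A, inner ℝ (z + t • w) m ≤ 1 := by
      rw [Filter.eventually_all_finset]
      intro m hm
      by_cases hmn : m = n
      · subst hmn
        refine Eventually.of_forall fun t => ?_
        exact (hline t).le
      · have hc : Continuous fun t : ℝ => inner ℝ (z + t • w) m := by fun_prop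
        have := hc.continuousAt (x := 0)
        refine (this.eventually_lt continuousAt_const ?_).mono fun t ht => ht.le
        simpa using hzm m hm hmn
    exact this
  have hTc : IsClosed T := (isClosed_polygon A).preimage (by fun_prop)
  have hTb : Bornology.IsBounded T := by
    obtain ⟨R, hR⟩ := hb.exists_norm_le
    refine isBounded_iff_forall_norm_le.2 ⟨(R + ‖z‖) / ‖w‖, fun t ht => ?_⟩
    rw [le_div_iff₀ (norm_pos_iff.2 hw0), ← norm_smul]
    calc ‖t • w‖ = ‖(z + t • w) - z‖ := by congr 1; abel
      _ ≤ ‖z + t • w‖ + ‖z‖ := norm_sub_le _ _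
      _ ≤ R + ‖z‖ := by gcongr; exact hR _ ht
  have hTk : IsCompact T := Metric.isCompact_of_isClosed_isBounded hTc hTb
  have hT0 : (0 : ℝ) ∈ T := mem_of_mem_nhds hTn
  have ha := hTk.sInf_mem ⟨0, hT0⟩
  have hbm := hTk.sSup_mem ⟨0, hT0⟩
  have hla : ∀ t ∈ T, sInf T ≤ t := fun t ht => csInf_le hTk.bddBelow ht
  have hub : ∀ t ∈ T, t ≤ sSup T := fun t ht => le_csSup hTk.bddAbove ht
  set a := sInf T
  set b := sSup T
  obtain ⟨ε, hε, hεT⟩ := Metric.mem_nhds_iff.1 hTn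
  have hmε : ε / 2 ∈ T := hεT (by simp [abs_of_pos hε, hε])
  have hab : a < b := by linarith [hla 0 hT0, hub _ hmε]
  have key : ∀ t ∈ T, ((∀ u ∈ T, t ≤ u) ∨ (∀ u ∈ T, u ≤ t)) →
      z + t • w ∈ (polygon A).extremePoints ℝ := by
    intro t ht hext
    refine mem_extremePoints_iff_left.2 ⟨ht, fun x₁ h₁ x₂ h₂ hx => ?_⟩
    obtain ⟨α, β, hα, hβ, hαβ, he⟩ := hx
    have hin : α * inner ℝ x₁ n + β * inner ℝ x₂ n = 1 := by
      rw [← real_inner_smul_left, ← real_inner_smul_left, ← inner_add_left, he, hline]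
    have e₁ : inner ℝ x₁ n = 1 := by nlinarith [h₁ n hnA, h₂ n hnA]
    have e₂ : inner ℝ x₂ n = 1 := by nlinarith [h₁ n hnA, h₂ n hnA]
    obtain ⟨t₁, ht₁⟩ := exists_eq_smul_perp (z := x₁ - z) hn0 (by rw [inner_sub_left, e₁, hzn, sub_self])
    obtain ⟨t₂, ht₂⟩ := exists_eq_smul_perp (z := x₂ - z) hn0 (by rw [inner_sub_left, e₂, hzn, sub_self])
    obtain rfl : x₁ = z + t₁ • w := by rw [hw, ← ht₁]; abel
    obtain rfl : x₂ = z + t₂ • w := by rw [hw, ← ht₂]; abel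
    have hc : α * t₁ + β * t₂ = t := by
      apply hinj
      rw [← he]
      have : z = (α + β) • z := by rw [hαβ, one_smul]
      nth_rewrite 1 [this]
      module
    have : t₁ = t := by
      have e : α * (t₁ - t) + β * (t₂ - t) = 0 := by linear_combination hc - t * hαβ
      rcases hext with h | h
      · have := mul_nonneg hβ.le (sub_nonneg.2 (h t₂ h₂))
        have h' := sub_nonneg.2 (h t₁ h₁)
        nlinarith [mul_nonneg hα.le h']
      · have := mul_nonneg hβ.le (sub_nonneg.2 (h t₂ h₂))
        have h' := sub_nonneg.2 (h t₁ h₁)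
        nlinarith [mul_nonneg hα.le h']
    rw [this]
  refine ⟨z + a • w, z + b • w, fun h => hab.ne (hinj _ _ h), ?_⟩
  ext v
  simp only [Set.mem_ofPred_eq, Set.mem_insert_iff, Set.mem_singleton_iff]
  constructor
  · rintro ⟨hv, hvn⟩
    obtain ⟨t, ht⟩ := exists_eq_smul_perp (z := v - z) hn0 (by rw [inner_sub_left, hvn, hzn, sub_self])
    obtain rfl : v = z + t • w := by rw [hw, ← ht]; abel
    have htT : t ∈ T := hv.1
    by_contra! hne
    have h1 : a < t := lt_of_le_of_ne (hla t htT) fun h => hne.1 (by rw [h])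
    have h2 : t < b := lt_of_le_of_ne (hub t htT) fun h => hne.2 (by rw [h])
    have := (mem_extremePoints.1 hv).2 _ ha _ hbm
      ⟨(b - t) / (b - a), (t - a) / (b - a), div_pos (by linarith) (by linarith),
        div_pos (by linarith) (by linarith), by field_simp [sub_ne_zero.2 hab.ne']; ring, by
          have hne' : b - a ≠ 0 := sub_ne_zero.2 hab.ne'
          have e1 : (b - t) / (b - a) + (t - a) / (b - a) = 1 := by field_simp; ring
          have e2 : (b - t) / (b - a) * a + (t - a) / (b - a) * b = t := by field_simp; ring
          calc _ = ((b - t) / (b - a) + (t - a) / (b - a)) • z +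
                ((b - t) / (b - a) * a + (t - a) / (b - a) * b) • w := by module
            _ = _ := by rw [e1, e2, one_smul]⟩
    exact h1.ne (hinj _ _ this.1)
  · rintro (rfl | rfl)
    · exact ⟨key a ha (Or.inl hla), hline _⟩
    · exact ⟨key b hbm (Or.inr hub), hline _⟩

/-- Choose `τ` between the value of `j` at `b` and its values at the other active normals. A small
step from `v` along `j - τ • v` violates only the constraint `b`: other active constraints decrease,
inactive ones survive by continuity. -/
theorem essential_of_forall_inner_lt {A : Finset Plane} {v j b : Plane} (hv : v ∈ polygon A)
    (hbA : b ∈ A) (hb : inner ℝ v b = 1)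
    (hmax : ∀ m ∈ A, inner ℝ v m = 1 → m ≠ b → inner ℝ j m < inner ℝ j b) :
    b ∈ essentialNormals A := by
  obtain ⟨τ, hτ, hτA⟩ : ∃ τ < inner ℝ j b, ∀ m ∈ A, inner ℝ v m = 1 → m ≠ b →
      inner ℝ j m < τ := by
    have h1 : ∀ᶠ τ in 𝓝[<] (inner ℝ j b), ∀ m ∈ A, inner ℝ v m = 1 → m ≠ b →
        inner ℝ j m < τ := by
      rw [Filter.eventually_all_finset]
      intro m hm
      by_cases h : inner ℝ v m = 1 ∧ m ≠ b
      · exact ((lt_mem_nhds (hmax m hm h.1 h.2)).filter_mono nhdsWithin_le_nhds).mono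
          fun τ hτ _ _ => hτ
      · exact Eventually.of_forall fun τ h1 h2 => absurd ⟨h1, h2⟩ h
    obtain ⟨τ, h, h'⟩ := (h1.and self_mem_nhdsWithin).exists
    exact ⟨τ, h', h⟩
  have h2 : ∀ᶠ δ in 𝓝[>] (0 : ℝ), ∀ m ∈ A, m ≠ b → inner ℝ (v + δ • (j - τ • v)) m ≤ 1 := by
    rw [Filter.eventually_all_finset]
    intro m hm
    by_cases hm1 : inner ℝ v m = 1
    · filter_upwards [self_mem_nhdsWithin] with δ hδ hmb
      have hδ' : (0 : ℝ) < δ := hδ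
      rw [inner_add_left, real_inner_smul_left, inner_sub_left, real_inner_smul_left, hm1]
      nlinarith [hτA m hm hm1 hmb]
    · have hlt : inner ℝ v m < 1 := lt_of_le_of_ne (hv m hm) hm1
      have hc : Continuous fun δ : ℝ => inner ℝ (v + δ • (j - τ • v)) m := by fun_prop
      have := (hc.continuousAt (x := 0)).eventually_lt (continuousAt_const (y := (1 : ℝ)))
        (by simpa using hlt)
      exact (this.filter_mono nhdsWithin_le_nhds).mono fun δ h _ => h.le
  obtain ⟨δ, h, hδ⟩ := (h2.and self_mem_nhdsWithin).exists
  have hδ' : (0 : ℝ) < δ := hδ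
  refine ⟨hbA, v + δ • (j - τ • v), ?_, h⟩
  rw [inner_add_left, real_inner_smul_left, inner_sub_left, real_inner_smul_left, hb]
  nlinarith

theorem eq_of_inner_eq {v a b : Plane} (hv : v ≠ 0) (h : inner ℝ v a = inner ℝ v b)
    (h' : inner ℝ (perp v) a = inner ℝ (perp v) b) : a = b := by
  have hp := normSq_pos hv
  rw [inner_eq, inner_eq] at h h'
  simp only [perp_zero, perp_one] at h'
  refine plane_ext (mul_left_cancel₀ hp.ne' ?_) (mul_left_cancel₀ hp.ne' ?_)
  · linear_combination v 0 * h - v 1 * h'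
  · linear_combination v 1 * h + v 0 * h'

/-- The normals active at `v` lie on the line `⟨v, m⟩ = 1` and are ordered by their component along
`perp v`. The two extreme ones are essential; any normal between them is a convex combination of
these two, hence redundant. -/
theorem vertex_essential {A : Finset Plane} {v : Plane}
    (hv : v ∈ (polygon A).extremePoints ℝ) :
    ∃ p q : Plane, p ≠ q ∧ {n | n ∈ essentialNormals A ∧ inner ℝ v n = 1} = {p, q} := by
  classical
  set I := A.filter fun m => inner ℝ v m = 1 with hI
  have hvP : v ∈ polygon A := hv.1
  -- A direction orthogonal to all active normals could be followed both ways from `v`, against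
  -- extremality.
  have hmove : ∀ w : Plane, (∀ m ∈ I, inner ℝ w m = 0) → w = 0 := by
    intro w hw
    have : ∀ᶠ δ in 𝓝[>] (0 : ℝ), ∀ m ∈ A, inner ℝ (v + δ • w) m ≤ 1 ∧
        inner ℝ (v - δ • w) m ≤ 1 := by
      rw [Filter.eventually_all_finset]
      intro m hm
      by_cases hm1 : inner ℝ v m = 1
      · have := hw m (by simp [hI, hm, hm1])
        exact Eventually.of_forall fun δ => by
          rw [inner_add_left, inner_sub_left, real_inner_smul_left, this, hm1]; simp
      · have hlt : inner ℝ v m < 1 := lt_of_le_of_ne (hvP m hm) hm1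
        have hc : Continuous fun δ : ℝ => inner ℝ (v + δ • w) m := by fun_prop
        have hc' : Continuous fun δ : ℝ => inner ℝ (v - δ • w) m := by fun_prop
        have h1 := (hc.continuousAt (x := 0)).eventually_lt (continuousAt_const (y := (1 : ℝ)))
          (by simpa using hlt)
        have h2 := (hc'.continuousAt (x := 0)).eventually_lt (continuousAt_const (y := (1 : ℝ)))
          (by simpa using hlt)
        exact ((h1.and h2).filter_mono nhdsWithin_le_nhds).mono fun δ h => ⟨h.1.le, h.2.le⟩
    obtain ⟨δ, h, hδ⟩ := (this.and self_mem_nhdsWithin).exists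
    have hδ' : (0 : ℝ) < δ := hδ
    have := (mem_extremePoints.1 hv).2 (v + δ • w) (fun m hm => (h m hm).1) (v - δ • w)
      (fun m hm => (h m hm).2) ⟨1 / 2, 1 / 2, by norm_num, by norm_num, by norm_num, by module⟩
    simpa [hδ'.ne'] using this.1
  have hIne : I.Nonempty := by
    by_contra h
    rw [Finset.not_nonempty_iff_eq_empty] at h
    have := hmove (!₂[1, 0]) (by simp [h])
    simpa using congrArg (fun z : Plane => z 0) this
  have hmem : ∀ m, m ∈ I ↔ m ∈ A ∧ inner ℝ v m = 1 := fun m => by simp [hI]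
  have hv0 : v ≠ 0 := by
    rintro rfl
    obtain ⟨m, hm⟩ := hIne
    simpa using ((hmem m).1 hm).2
  have hinj : ∀ m ∈ I, ∀ n ∈ I, inner ℝ (perp v) m = inner ℝ (perp v) n → m = n :=
    fun m hm n hn h => eq_of_inner_eq hv0 (((hmem m).1 hm).2.trans ((hmem n).1 hn).2.symm) h
  obtain ⟨a, haI, ha⟩ := I.exists_min_image (fun m => inner ℝ (perp v) m) hIne
  obtain ⟨b, hbI, hb⟩ := I.exists_max_image (fun m => inner ℝ (perp v) m) hIne
  have hab : a ≠ b := by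
    rintro rfl
    have ha0 : a ≠ 0 := by
      rintro rfl
      simpa using ((hmem _).1 haI).2
    refine perp_ne_zero ha0 (hmove _ fun m hm => ?_)
    rw [hinj m hm a haI (le_antisymm (hb m hm) (ha m hm)), inner_perp_left]
  have haA := (hmem a).1 haI
  have hbA := (hmem b).1 hbI
  refine ⟨a, b, hab, ?_⟩
  ext n
  simp only [Set.mem_ofPred_eq, Set.mem_insert_iff, Set.mem_singleton_iff]
  constructor
  · rintro ⟨⟨hnA, y, hy, hyA⟩, hvn⟩
    by_contra! hne
    have hnI : n ∈ I := (hmem n).2 ⟨hnA, hvn⟩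
    have h1 : inner ℝ (perp v) a < inner ℝ (perp v) n :=
      lt_of_le_of_ne (ha n hnI) fun h => hne.1 (hinj _ haI _ hnI h).symm
    have h2 : inner ℝ (perp v) n < inner ℝ (perp v) b :=
      lt_of_le_of_ne (hb n hnI) fun h => hne.2 (hinj _ hnI _ hbI h)
    set ta := inner ℝ (perp v) a
    set tb := inner ℝ (perp v) b
    set t := inner ℝ (perp v) n with ht
    have hd : tb - ta ≠ 0 := by linarith
    have hn : n = ((tb - t) / (tb - ta)) • a + ((t - ta) / (tb - ta)) • b := by
      refine eq_of_inner_eq hv0 ?_ ?_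
      · rw [inner_add_right, inner_smul_right, inner_smul_right, haA.2, hbA.2, hvn]
        field_simp; ring
      · rw [inner_add_right, inner_smul_right, inner_smul_right, ← ht]
        change t = _ * ta + _ * tb
        field_simp; ring
    have hya := hyA a haA.1 hne.1.symm
    have hyb := hyA b hbA.1 hne.2.symm
    rw [hn, inner_add_right, inner_smul_right, inner_smul_right, div_mul_eq_mul_div,
      div_mul_eq_mul_div, ← add_div, lt_div_iff₀ (by linarith)] at hy
    nlinarith
  · rintro (rfl | rfl)
    · refine ⟨essential_of_forall_inner_lt (j := -perp v) hvP haA.1 haA.2 fun m hm hvm hmn => ?_,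
        haA.2⟩
      rw [inner_neg_left, inner_neg_left, neg_lt_neg_iff]
      have hmI := (hmem m).2 ⟨hm, hvm⟩
      exact lt_of_le_of_ne (ha m hmI) fun h => hmn (hinj _ haI _ hmI h).symm
    · refine ⟨essential_of_forall_inner_lt (j := perp v) hvP hbA.1 hbA.2 fun m hm hvm hmn => ?_,
        hbA.2⟩
      have hmI := (hmem m).2 ⟨hm, hvm⟩
      exact lt_of_le_of_ne (hb m hmI) fun h => hmn (hinj _ hmI _ hbI h)

theorem finite_extremePoints_polygon {A : Finset Plane}
    (hb : Bornology.IsBounded (polygon A)) : ((polygon A).extremePoints ℝ).Finite := by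
  have hE : (essentialNormals A).Finite := A.finite_toSet.subset fun n hn => hn.1
  refine (hE.biUnion (t := fun n => {v | v ∈ (polygon A).extremePoints ℝ ∧ inner ℝ v n = 1})
    fun n hn => ?_).subset fun v hv => ?_
  · obtain ⟨p, q, -, h⟩ := essential_edge hb hn
    rw [h]; exact Set.toFinite _
  · obtain ⟨p, q, -, h⟩ := vertex_essential hv
    have hp : p ∈ {n | n ∈ essentialNormals A ∧ inner ℝ v n = 1} := h ▸ Set.mem_insert _ _
    exact Set.mem_biUnion hp.1 ⟨hv, hp.2⟩

/-- Double counting of incidences: two vertices on each essential line, two essential lines through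
each vertex. -/
theorem ncard_extremePoints_polygon {A : Finset Plane}
    (hb : Bornology.IsBounded (polygon A)) :
    ((polygon A).extremePoints ℝ).ncard = (essentialNormals A).ncard := by
  classical
  have hE : (essentialNormals A).Finite := A.finite_toSet.subset fun n hn => hn.1
  have hV := finite_extremePoints_polygon hb
  rw [Set.ncard_eq_toFinset_card _ hE, Set.ncard_eq_toFinset_card _ hV]
  refine Nat.eq_of_mul_eq_mul_right (m := 2) two_pos
    (Finset.card_mul_eq_card_mul (fun v n => inner ℝ v n = 1) (fun v hv => ?_) fun n hn => ?_)
  · obtain ⟨p, q, hpq, h⟩ := vertex_essential (hV.mem_toFinset.1 hv)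
    refine Eq.trans (congrArg Finset.card ?_) (Finset.card_pair hpq)
    ext n
    simpa [Finset.bipartiteAbove] using Set.ext_iff.1 h n
  · obtain ⟨p, q, hpq, h⟩ := essential_edge hb (hE.mem_toFinset.1 hn)
    refine Eq.trans (congrArg Finset.card ?_) (Finset.card_pair hpq)
    ext v
    simpa [Finset.bipartiteBelow] using Set.ext_iff.1 h v

/-! ### The cell of the origin for a locally finite set of nuclei -/

theorem mem_ball_norm_iff {x y : Plane} :
    x ∈ Metric.ball y ‖y‖ ↔ ‖x‖ ^ 2 < 2 * inner ℝ y x := by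
  rw [mem_ball_iff_norm, ← sq_lt_sq₀ (norm_nonneg _) (norm_nonneg _), norm_sub_sq_real,
    real_inner_comm x y]
  constructor <;> intro h <;> linarith

/-- The points `y` such that the open disk around `y` through the origin misses `N`. -/
def emptyCell (N : Set Plane) : Set Plane := {y | N ∩ Metric.ball y ‖y‖ = ∅}

/-- The points `x` of `N` that are the only ones in some open disk with the origin on its
boundary. -/
def neighbours (N : Set Plane) : Set Plane := {x | ∃ y : Plane, N ∩ Metric.ball y ‖y‖ = {x}}

theorem mem_emptyCell {N : Set Plane} {y : Plane} :
    y ∈ emptyCell N ↔ ∀ x ∈ N, 2 * inner ℝ y x ≤ ‖x‖ ^ 2 := by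
  simp only [emptyCell, Set.mem_ofPred_eq, Set.eq_empty_iff_forall_notMem, Set.mem_inter_iff,
    mem_ball_norm_iff, not_and, not_lt]

theorem inter_ball_eq_singleton_iff {N : Set Plane} {x y : Plane} :
    N ∩ Metric.ball y ‖y‖ = {x} ↔ x ∈ N ∧ ‖x‖ ^ 2 < 2 * inner ℝ y x ∧
      ∀ x' ∈ N, x' ≠ x → 2 * inner ℝ y x' ≤ ‖x'‖ ^ 2 := by
  rw [Set.eq_singleton_iff_unique_mem]
  simp only [Set.mem_inter_iff, mem_ball_norm_iff, and_imp, and_assoc]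
  refine and_congr_right fun _ => and_congr_right fun _ => forall_congr' fun x' => ?_
  refine imp_congr_right fun _ => ?_
  rw [← not_lt, not_imp_not]

theorem smul_mem_emptyCell {N : Set Plane} {y : Plane} (hy : y ∈ emptyCell N) {c : ℝ} (h0 : 0 ≤ c)
    (h1 : c ≤ 1) : c • y ∈ emptyCell N := by
  rw [mem_emptyCell] at hy ⊢
  intro x hx
  rw [real_inner_smul_left]
  nlinarith [hy x hx, sq_nonneg ‖x‖]

/-- Shrinking `y` to `c₀ • y` puts `x` on the boundary of the disk, so `c₀ • y` is in the cell and
has norm at most `R`. Moving outward again by at most 1, and not past `y`, captures `x` and nothing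
else. -/
theorem exists_norm_le_inter_ball_eq {N : Set Plane} {R : ℝ} (hR : ∀ z ∈ emptyCell N, ‖z‖ ≤ R)
    {x y : Plane} (h : N ∩ Metric.ball y ‖y‖ = {x}) :
    ∃ z : Plane, ‖z‖ ≤ R + 1 ∧ N ∩ Metric.ball z ‖z‖ = {x} := by
  obtain ⟨hxN, hx, hN⟩ := inter_ball_eq_singleton_iff.1 h
  have hi : 0 < 2 * inner ℝ y x := lt_of_le_of_lt (sq_nonneg _) hx
  have hy : 0 < ‖y‖ := norm_pos_iff.2 (by rintro rfl; simp at hi)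
  set c₀ := ‖x‖ ^ 2 / (2 * inner ℝ y x) with hc₀
  have h0 : 0 ≤ c₀ := by positivity
  have h1 : c₀ < 1 := (div_lt_one hi).2 hx
  have hc₀y : ‖c₀ • y‖ ≤ R := hR _ <| mem_emptyCell.2 fun x' hx' => by
    rw [real_inner_smul_left]
    by_cases hxx : x' = x
    · subst hxx
      have hne : inner ℝ y x' ≠ 0 := fun h => by simp [h] at hi
      refine le_of_eq ?_
      rw [hc₀]; field_simp
    · nlinarith [hN x' hx' hxx, sq_nonneg ‖x'‖]
  set c := min 1 (c₀ + 1 / ‖y‖) with hc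
  have hcc : c₀ < c := lt_min h1 (by linarith [one_div_pos.2 hy])
  have hc1 : c ≤ 1 := min_le_left _ _
  refine ⟨c • y, ?_, inter_ball_eq_singleton_iff.2 ⟨hxN, ?_, fun x' hx' hxx => ?_⟩⟩
  · rw [norm_smul, Real.norm_of_nonneg (h0.trans hcc.le)]
    rw [norm_smul, Real.norm_of_nonneg h0] at hc₀y
    calc c * ‖y‖ ≤ (c₀ + 1 / ‖y‖) * ‖y‖ := by gcongr; exact min_le_right _ _
      _ = c₀ * ‖y‖ + 1 := by field_simp
      _ ≤ R + 1 := by gcongr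
  · rw [real_inner_smul_left]
    have := (div_lt_iff₀ hi).1 hcc
    linarith
  · rw [real_inner_smul_left]
    nlinarith [hN x' hx' hxx, sq_nonneg ‖x'‖, h0.trans hcc.le]

/-- The normal of the half-plane of points closer to the origin than to `x`. -/
def bisectorNormal (x : Plane) : Plane := (2 / ‖x‖ ^ 2) • x

theorem inner_bisectorNormal_le_one {x y : Plane} (hx : x ≠ 0) :
    inner ℝ y (bisectorNormal x) ≤ 1 ↔ 2 * inner ℝ y x ≤ ‖x‖ ^ 2 := by
  have : 0 < ‖x‖ ^ 2 := by positivity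
  rw [bisectorNormal, inner_smul_right, div_mul_eq_mul_div, div_le_one this]

theorem bisectorNormal_bisectorNormal {x : Plane} (hx : x ≠ 0) :
    bisectorNormal (bisectorNormal x) = x := by
  have : ‖x‖ ≠ 0 := norm_ne_zero_iff.2 hx
  simp only [bisectorNormal, smul_smul, norm_smul, norm_div, norm_pow, norm_norm, Real.norm_ofNat]
  have : 2 / (2 / ‖x‖ ^ 2 * ‖x‖) ^ 2 * (2 / ‖x‖ ^ 2) = 1 := by field_simp
  rw [this, one_smul]

/-- Reduction to finitely many half-planes: for centres of norm at most `R + 1` the disk through the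
origin stays in the ball of radius `2 * R + 2`, so only the nuclei in that ball matter. Essential
normals then correspond to neighbours through the involution `bisectorNormal`. -/
theorem extremePoints_emptyCell {N : Set Plane}
    (hN : ∀ B, Bornology.IsBounded B → (N ∩ B).Finite) (h0 : (0 : Plane) ∉ N)
    (hb : Bornology.IsBounded (emptyCell N)) :
    ((emptyCell N).extremePoints ℝ).Finite ∧ (neighbours N).Finite ∧
      ((emptyCell N).extremePoints ℝ).ncard = (neighbours N).ncard := by
  classical
  obtain ⟨R, hR⟩ := hb.exists_norm_le
  have hfin := hN (Metric.ball 0 (2 * R + 2)) Metric.isBounded_ball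
  set S := hfin.toFinset with hS
  have hmS : ∀ x, x ∈ S ↔ x ∈ N ∧ ‖x‖ < 2 * R + 2 := fun x => by simp [hS]
  have hSN : (S : Set Plane) ⊆ N := fun x hx => ((hmS x).1 hx).1
  have hS0 : ∀ x ∈ S, x ≠ 0 := fun x hx h => h0 (h ▸ hSN hx)
  have hfar : ∀ z : Plane, ‖z‖ ≤ R + 1 → ∀ x ∈ N, x ∉ S → 2 * inner ℝ z x ≤ ‖x‖ ^ 2 := by
    intro z hz x hx hxS
    have h1 : 2 * R + 2 ≤ ‖x‖ := not_lt.1 fun h => hxS ((hmS x).2 ⟨hx, h⟩)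
    have h2 := real_inner_le_norm z x
    nlinarith [norm_nonneg x]
  have hnear : ∀ z ∈ emptyCell (S : Set Plane), ‖z‖ ≤ R + 1 → z ∈ emptyCell N := by
    intro z hz hzR
    rw [mem_emptyCell] at hz ⊢
    intro x hx
    by_cases hxS : x ∈ S
    · exact hz x hxS
    · exact hfar z hzR x hx hxS
  have hcell : emptyCell (S : Set Plane) = emptyCell N := by
    refine Set.Subset.antisymm (fun y hy => ?_) fun y hy => ?_
    · rcases le_or_gt ‖y‖ (R + 1) with h | h
      · exact hnear y hy h
      · have hR0 : 0 ≤ R := (norm_nonneg _).trans (hR 0 (mem_emptyCell.2 (by simp)))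
        have hy0 : 0 < ‖y‖ := by linarith
        have hn : ‖((R + 1) / ‖y‖) • y‖ = R + 1 := by
          rw [norm_smul, Real.norm_of_nonneg (by positivity)]; field_simp
        have := hR _ (hnear _ (smul_mem_emptyCell hy (by positivity) ((div_le_one hy0).2 h.le))
          hn.le)
        linarith
    · rw [mem_emptyCell] at hy ⊢
      exact fun x hx => hy x (hSN hx)
  have hpoly : polygon (S.image bisectorNormal) = emptyCell N := by
    rw [← hcell]
    ext y
    rw [mem_emptyCell]
    simp only [polygon, Finset.mem_image, forall_exists_index, and_imp, forall_apply_eq_imp_iff₂,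
      Set.mem_ofPred_eq, Finset.mem_coe]
    exact forall₂_congr fun x hx => inner_bisectorNormal_le_one (hS0 x hx)
  have hinj : Set.InjOn bisectorNormal (S : Set Plane) := fun x hx y hy h => by
    rw [← bisectorNormal_bisectorNormal (hS0 x hx), h, bisectorNormal_bisectorNormal (hS0 y hy)]
  have hnb : neighbours N ⊆ S := by
    rintro x ⟨y, hy⟩
    obtain ⟨z, hz, hxz⟩ := exists_norm_le_inter_ball_eq hR hy
    obtain ⟨h1, h2, -⟩ := inter_ball_eq_singleton_iff.1 hxz
    by_contra hxS
    exact absurd (hfar z hz x h1 hxS) (not_le.2 h2)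
  have hess : essentialNormals (S.image bisectorNormal) = bisectorNormal '' neighbours N := by
    ext n
    constructor
    · rintro ⟨hn, y, hy, hyA⟩
      obtain ⟨x, hx, rfl⟩ := Finset.mem_image.1 hn
      have hS' : (S : Set Plane) ∩ Metric.ball y ‖y‖ = {x} := by
        refine inter_ball_eq_singleton_iff.2 ⟨hx, ?_, fun x' hx' hne => ?_⟩
        · rw [← not_le, ← inner_bisectorNormal_le_one (hS0 x hx), not_le]; exact hy
        · rw [← inner_bisectorNormal_le_one (hS0 x' hx')]
          exact hyA _ (Finset.mem_image_of_mem _ hx') fun h => hne (hinj hx' hx h)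
      obtain ⟨z, hz, hxz⟩ := exists_norm_le_inter_ball_eq (R := R) (by rwa [hcell]) hS'
      obtain ⟨h1, h2, h3⟩ := inter_ball_eq_singleton_iff.1 hxz
      refine ⟨x, ⟨z, inter_ball_eq_singleton_iff.2 ⟨hSN h1, h2, fun x' hx' hne => ?_⟩⟩, rfl⟩
      by_cases hxS : x' ∈ S
      · exact h3 x' hxS hne
      · exact hfar z hz x' hx' hxS
    · rintro ⟨x, hx, rfl⟩
      have hxS := hnb hx
      obtain ⟨y, hy⟩ := hx
      obtain ⟨h1, h2, h3⟩ := inter_ball_eq_singleton_iff.1 hy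
      refine ⟨Finset.mem_image_of_mem _ hxS, y, ?_, fun m hm hne => ?_⟩
      · rw [← not_le, inner_bisectorNormal_le_one (hS0 x hxS), not_le]; exact h2
      · obtain ⟨x', hx', rfl⟩ := Finset.mem_image.1 hm
        rw [inner_bisectorNormal_le_one (hS0 x' hx')]
        exact h3 x' (hSN hx') fun h => hne (h ▸ rfl)
  rw [← hpoly] at hb ⊢
  refine ⟨finite_extremePoints_polygon hb, S.finite_toSet.subset hnb, ?_⟩
  rw [ncard_extremePoints_polygon hb, hess, (hinj.mono hnb).ncard_image]

/-! ### Voronoi flowers and the cell around a convex body -/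

theorem mem_flower {L : Set Plane} {x : Plane} :
    x ∈ flower 0 L ↔ ∃ s ∈ L, ‖x‖ ^ 2 ≤ inner ℝ s x := by
  simp only [flower, add_zero, sub_zero, Set.mem_iUnion, exists_prop]
  refine exists_congr fun s => and_congr_right fun _ => ?_
  rw [mem_closedBall_iff_norm, ← sq_le_sq₀ (norm_nonneg _) (by positivity), norm_sub_sq_real,
    inner_smul_right, norm_smul, real_inner_comm, Real.norm_of_nonneg (by norm_num)]
  constructor <;> intro h <;> linarith

theorem mem_two_smul_flower {L : Set Plane} {x : Plane} :
    x ∈ (2 : ℝ) • flower 0 L ↔ ∃ s ∈ L, ‖x‖ ^ 2 ≤ 2 * inner ℝ s x := by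
  rw [Set.mem_smul_set_iff_inv_smul_mem₀ two_ne_zero, mem_flower]
  refine exists_congr fun s => and_congr_right fun _ => ?_
  rw [norm_smul, inner_smul_right, Real.norm_of_nonneg (by norm_num)]
  constructor <;> intro h <;> linarith

theorem isClosed_flower {L : Set Plane} (hL : IsCompact L) : IsClosed (flower 0 L) := by
  have : flower 0 L = (fun p : Plane × Plane => (1 / 2 : ℝ) • p.1 + (1 / 2 * ‖p.1‖) • p.2) ''
      (L ×ˢ Metric.closedBall 0 1) := by
    ext x
    simp only [flower, add_zero, sub_zero, Set.mem_iUnion, exists_prop, Set.mem_image,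
      Set.mem_prod, Prod.exists]
    refine exists_congr fun s => ⟨fun ⟨hs, hx⟩ => ?_, fun ⟨b, ⟨hs, hb⟩, hx⟩ => ⟨hs, ?_⟩⟩
    · have : Metric.closedBall ((1 / 2 : ℝ) • s) (1 / 2 * ‖s‖) =
          {(1 / 2 : ℝ) • s} + (1 / 2 * ‖s‖) • Metric.closedBall (0 : Plane) 1 := by
        rw [smul_unitClosedBall_of_nonneg (by positivity), singleton_add_closedBall, add_zero]
      rw [this, Set.singleton_add] at hx
      obtain ⟨_, ⟨b, hb, rfl⟩, hx⟩ := hx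
      exact ⟨b, ⟨hs, hb⟩, hx⟩
    · rw [← hx, mem_closedBall_iff_norm, add_sub_cancel_left, norm_smul,
        Real.norm_of_nonneg (by positivity)]
      exact mul_le_of_le_one_right (by positivity) (mem_closedBall_zero_iff.1 hb)
  rw [this]
  exact ((hL.prod (isCompact_closedBall 0 1)).image (by fun_prop)).isClosed

theorem isClosed_two_smul_flower {L : Set Plane} (hL : IsCompact L) :
    IsClosed ((2 : ℝ) • flower 0 L) := (isClosed_flower hL).smul_of_ne_zero two_ne_zero

theorem flower_mono {L M : Set Plane} (h : L ⊆ M) : flower 0 L ⊆ flower 0 M :=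
  Set.biUnion_subset_biUnion_left h

theorem flower_subset_closedBall {L : Set Plane} {R : ℝ} (hR : ∀ s ∈ L, ‖s‖ ≤ R) :
    flower 0 L ⊆ Metric.closedBall 0 R := by
  intro x hx
  obtain ⟨s, hs, h⟩ := mem_flower.1 hx
  rw [mem_closedBall_zero_iff]
  have h1 := real_inner_le_norm s x
  rcases (norm_nonneg x).eq_or_lt with h0 | h0
  · rw [← h0]; exact (norm_nonneg s).trans (hR s hs)
  · nlinarith [hR s hs]

theorem cellAround_eq (K χ : Set Plane) :
    cellAround K χ = emptyCell (χ ∩ ((2 : ℝ) • flower 0 K)ᶜ) := by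
  ext y
  rw [cellAround, voronoiCell, emptyCell]
  simp only [Set.mem_ofPred_eq, sub_zero, Set.union_singleton, Set.forall_mem_insert, le_refl,
    true_and, Set.eq_empty_iff_forall_notMem, Set.mem_inter_iff, mem_ball_iff_norm, not_and, not_lt]
  exact forall₂_congr fun x _ => by rw [norm_sub_rev]

theorem convex_emptyCell (N : Set Plane) : Convex ℝ (emptyCell N) := by
  intro x hx y hy a b ha hb hab
  rw [mem_emptyCell] at hx hy ⊢
  intro z hz
  rw [inner_add_left, real_inner_smul_left, real_inner_smul_left]
  have : ‖z‖ ^ 2 = a * ‖z‖ ^ 2 + b * ‖z‖ ^ 2 := by rw [← add_mul, hab, one_mul]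
  nlinarith [hx z hz, hy z hz]

theorem isClosed_emptyCell (N : Set Plane) : IsClosed (emptyCell N) := by
  have : emptyCell N = ⋂ x ∈ N, {y | 2 * inner ℝ y x ≤ ‖x‖ ^ 2} := by
    ext; simp [mem_emptyCell]
  rw [this]
  exact isClosed_biInter fun n _ => isClosed_le (by fun_prop) continuous_const

theorem emptyCell_anti {M N : Set Plane} (h : M ⊆ N) : emptyCell N ⊆ emptyCell M := fun _ hy =>
  mem_emptyCell.2 fun x hx => mem_emptyCell.1 hy x (h hx)

theorem subset_emptyCell (K χ : Set Plane) :
    K ⊆ emptyCell (χ ∩ ((2 : ℝ) • flower 0 K)ᶜ) := fun _ hy => mem_emptyCell.2 fun _ hx => by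
  by_contra! h
  exact hx.2 (mem_two_smul_flower.2 ⟨_, hy, h.le⟩)

/-- This is what replaces arbitrary disk centres by countably many: a convex set with interior
points lies in the closure of its interior. -/
theorem exists_denseSeq_mem {C U : Set Plane} (hC : Convex ℝ C) (h0 : (0 : Plane) ∈ interior C)
    (hU : IsOpen U) (h : (C ∩ U).Nonempty) :
    ∃ k, TopologicalSpace.denseSeq Plane k ∈ C ∩ U := by
  obtain ⟨y, hyC, hyU⟩ := h
  have hcl : y ∈ closure (interior C) := by
    rw [hC.closure_interior_eq_closure_of_nonempty_interior ⟨0, h0⟩]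
    exact subset_closure hyC
  have hne : (interior C ∩ U).Nonempty := by
    rw [Set.inter_comm]; exact mem_closure_iff.1 hcl U hU hyU
  obtain ⟨k, hk⟩ := (TopologicalSpace.denseRange_denseSeq Plane).exists_mem_open
    (isOpen_interior.inter hU) hne
  exact ⟨k, interior_subset hk.1, hk.2⟩

theorem neighbours_eq {N : Set Plane} (h0 : (0 : Plane) ∈ interior (emptyCell N)) :
    neighbours N = {x | ∃ k, N ∩ Metric.ball (TopologicalSpace.denseSeq Plane k)
      ‖TopologicalSpace.denseSeq Plane k‖ = {x}} := by
  ext x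
  refine ⟨fun ⟨y, hy⟩ => ?_, fun ⟨k, hk⟩ => ⟨_, hk⟩⟩
  obtain ⟨h1, h2, h3⟩ := inter_ball_eq_singleton_iff.1 hy
  -- The centres isolating `x` are those of the convex cell of `N \ {x}` that satisfy one open
  -- condition.
  obtain ⟨k, hk, hk'⟩ := exists_denseSeq_mem (convex_emptyCell (N \ {x}))
    (interior_mono (emptyCell_anti Set.sdiff_subset) h0)
    (U := {y | ‖x‖ ^ 2 < 2 * inner ℝ y x}) (isOpen_lt continuous_const (by fun_prop))
    ⟨y, mem_emptyCell.2 fun x' hx' => h3 x' hx'.1 hx'.2, h2⟩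
  exact ⟨k, inter_ball_eq_singleton_iff.2 ⟨h1, hk', fun x' hx' hne =>
    mem_emptyCell.1 hk x' ⟨hx', hne⟩⟩⟩

/-- The union `U` of open disks contains `c • V` minus the origin for every `0 < c < 1`; letting `c
→ 1` compares the areas, with no need to study the boundary of the flower. -/
theorem two_smul_flower_ae_eq {C : Set Plane} (hC : Convex ℝ C)
    (h0 : (0 : Plane) ∈ interior C) (hb : Bornology.IsBounded C) :
    {x | ∃ k, TopologicalSpace.denseSeq Plane k ∈ C ∧
      x ∈ Metric.ball (TopologicalSpace.denseSeq Plane k) ‖TopologicalSpace.denseSeq Plane k‖}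
      =ᵐ[volume] (2 : ℝ) • flower 0 C := by
  set U := {x | ∃ k, TopologicalSpace.denseSeq Plane k ∈ C ∧
      x ∈ Metric.ball (TopologicalSpace.denseSeq Plane k) ‖TopologicalSpace.denseSeq Plane k‖}
  set V := (2 : ℝ) • flower 0 C
  have hUo : IsOpen U := by
    have : U = ⋃ k, ⋃ (_ : TopologicalSpace.denseSeq Plane k ∈ C), Metric.ball
      (TopologicalSpace.denseSeq Plane k) ‖TopologicalSpace.denseSeq Plane k‖ := by
      ext; simp [U]
    rw [this]
    exact isOpen_iUnion fun k => isOpen_iUnion fun _ => Metric.isOpen_ball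
  have hUV : U ⊆ V := fun x ⟨k, hk, hx⟩ =>
    mem_two_smul_flower.2 ⟨_, hk, (mem_ball_norm_iff.1 hx).le⟩
  have hscale : ∀ c : ℝ, 0 < c → c < 1 → c • V ⊆ U ∪ {0} := by
    rintro c hc0 hc1 _ ⟨x, hx, rfl⟩
    obtain ⟨s, hs, h⟩ := mem_two_smul_flower.1 hx
    by_cases hx0 : x = 0
    · right; simp [hx0]
    left
    have hpos : 0 < ‖x‖ ^ 2 := by positivity
    obtain ⟨k, hk, hk'⟩ := exists_denseSeq_mem hC h0
      (U := {y | ‖c • x‖ ^ 2 < 2 * inner ℝ y (c • x)})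
      (isOpen_lt continuous_const (by fun_prop)) ⟨s, hs, by
        show ‖c • x‖ ^ 2 < 2 * inner ℝ s (c • x)
        rw [norm_smul, inner_smul_right, Real.norm_of_nonneg hc0.le, mul_pow]
        have : c ^ 2 * ‖x‖ ^ 2 < c * ‖x‖ ^ 2 := by
          apply mul_lt_mul_of_pos_right _ hpos; nlinarith
        nlinarith⟩
    exact ⟨k, hk, mem_ball_norm_iff.2 hk'⟩
  have hVfin : volume V ≠ ⊤ := by
    obtain ⟨R, hR⟩ := hb.exists_norm_le
    refine ((Metric.isBounded_closedBall.subset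
      (flower_subset_closedBall hR)).smul₀ (2 : ℝ)).measure_lt_top.ne
  refine ae_eq_of_subset_of_measure_ge hUV ?_ hUo.measurableSet.nullMeasurableSet hVfin
  have hle : ∀ c : ℝ, 0 < c → c < 1 → ENNReal.ofReal (c ^ 2) * volume V ≤ volume U := by
    intro c hc0 hc1
    have h1 := (measure_mono (hscale c hc0 hc1)).trans (measure_union_le (μ := volume) U {0})
    rw [Measure.addHaar_smul, measure_singleton, add_zero] at h1
    simpa [abs_of_pos hc0] using h1
  have hlim : Tendsto (fun c : ℝ => ENNReal.ofReal (c ^ 2) * volume V) (𝓝[<] 1)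
      (𝓝 (ENNReal.ofReal (1 ^ 2) * volume V)) := by
    refine ENNReal.Tendsto.mul_const ?_ (Or.inr hVfin)
    refine ENNReal.tendsto_ofReal ?_
    exact ((continuous_pow 2).tendsto (1 : ℝ)).mono_left nhdsWithin_le_nhds
  have := le_of_tendsto hlim (b := volume U) <| by
    have h1 : ∀ᶠ c : ℝ in 𝓝[<] 1, 0 < c := (lt_mem_nhds zero_lt_one).filter_mono nhdsWithin_le_nhds
    filter_upwards [h1, self_mem_nhdsWithin] with c h h'
    exact hle c h h'
  simpa using this

/-! ### A Mecke formula for finitely many test sets -/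

section Poisson

variable {Ω : Type*} [MeasurableSpace Ω] {P : Measure Ω} {l : ℝ} {X : Ω → Set Plane}

theorem IsPoissonProcess.ncard_eq_zero (hX : IsPoissonProcess P l X) {B : Set Plane}
    (hb : Bornology.IsBounded B) (ω : Ω) : (X ω ∩ B).ncard = 0 ↔ X ω ∩ B = ∅ :=
  Set.ncard_eq_zero (hX.locallyFinite ω B hb)

theorem IsPoissonProcess.measurableSet_inter_eq_empty (hX : IsPoissonProcess P l X) {B : Set Plane}
    (hB : MeasurableSet B) (hb : Bornology.IsBounded B) : MeasurableSet {ω | X ω ∩ B = ∅} := by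
  have := hX.measurable_count B hB hb (measurableSet_singleton 0)
  convert this using 1
  ext ω
  exact (hX.ncard_eq_zero hb ω).symm

theorem IsPoissonProcess.prob_ncard_eq (hX : IsPoissonProcess P l X) {B : Set Plane}
    (hB : MeasurableSet B) (hb : Bornology.IsBounded B) (n : ℕ) :
    P {ω | (X ω ∩ B).ncard = n} =
      poissonMeasure (l * volume.real B).toNNReal {n} := by
  rw [← hX.map_count B hB hb, Measure.map_apply (hX.measurable_count B hB hb)
    (measurableSet_singleton n)]
  rfl

theorem IsPoissonProcess.prob_inter_eq_empty (hX : IsPoissonProcess P l X) (hl : 0 < l)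
    {B : Set Plane} (hB : MeasurableSet B) (hb : Bornology.IsBounded B) :
    P {ω | X ω ∩ B = ∅} = ENNReal.ofReal (Real.exp (-(l * volume.real B))) := by
  have h := hX.prob_ncard_eq hB hb 0
  simp only [hX.ncard_eq_zero hb] at h
  rw [h, poissonMeasure_singleton, Real.coe_toNNReal _ (by positivity)]
  simp

/-- The Mecke formula for a single set, and its only use of the form of the Poisson weights. -/
theorem IsPoissonProcess.prob_ncard_eq_one (hX : IsPoissonProcess P l X) (hl : 0 < l)
    {B : Set Plane} (hB : MeasurableSet B) (hb : Bornology.IsBounded B) :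
    P {ω | (X ω ∩ B).ncard = 1} =
      ENNReal.ofReal l * volume B * P {ω | (X ω ∩ B).ncard = 0} := by
  rw [hX.prob_ncard_eq hB hb, hX.prob_ncard_eq hB hb, poissonMeasure_singleton,
    poissonMeasure_singleton, Real.coe_toNNReal _ (by positivity),
    ← ENNReal.ofReal_toReal hb.measure_lt_top.ne, ← ENNReal.ofReal_mul hl.le,
    ← ENNReal.ofReal_mul (by positivity)]
  congr 1
  simp [Measure.real]
  ring

theorem IsPoissonProcess.iIndepFun_count (hX : IsPoissonProcess P l X) {ι : Type*} [Fintype ι]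
    {B : ι → Set Plane} (hB : ∀ i, MeasurableSet (B i)) (hb : ∀ i, Bornology.IsBounded (B i))
    (hd : Pairwise fun i j => Disjoint (B i) (B j)) :
    iIndepFun (fun i ω => (X ω ∩ B i).ncard) P := by
  have e := Fintype.equivFin ι
  have h := (hX.indep_count _ (B ∘ e.symm) (fun i => hB _) (fun i => hb _)
    fun i j hij => hd (e.symm.injective.ne hij)).precomp e.injective
  simpa using h

/-- The set of points lying in exactly those `W k` with `k ∈ T`. -/
def atom {n : ℕ} (W : Fin n → Set Plane) (T : Finset (Fin n)) : Set Plane :=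
  {x | T.Nonempty ∧ ∀ k, x ∈ W k ↔ k ∈ T}

/-! ### Atoms generated by finitely many test sets -/

section atoms

variable {n : ℕ} {W : Fin n → Set Plane}

theorem atom_subset {T : Finset (Fin n)} {k : Fin n} (hk : k ∈ T) : atom W T ⊆ W k :=
  fun _ hx => (hx.2 k).2 hk

theorem measurableSet_atom (hW : ∀ k, MeasurableSet (W k)) (T : Finset (Fin n)) :
    MeasurableSet (atom W T) := by
  have : atom W T = {_x | T.Nonempty} ∩ ⋂ k, {x | x ∈ W k ↔ k ∈ T} := by
    ext; simp [atom]
  rw [this]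
  refine (MeasurableSet.const _).inter (MeasurableSet.iInter fun k => ?_)
  by_cases h : k ∈ T
  · simpa [h] using hW k
  · simp only [h, iff_false]
    exact (hW k).compl

/-- The nonemptiness built into `atom` matters here: without it the atom of `∅` would be the
unbounded common complement. -/
theorem isBounded_atom (hb : ∀ k, Bornology.IsBounded (W k)) (T : Finset (Fin n)) :
    Bornology.IsBounded (atom W T) := by
  rcases T.eq_empty_or_nonempty with rfl | ⟨k, hk⟩
  · have : atom W ∅ = ∅ := by ext; simp [atom]
    rw [this]; exact Bornology.isBounded_empty
  · exact (hb k).subset (atom_subset hk)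

theorem eq_of_mem_atom {S T : Finset (Fin n)} {x : Plane} (hS : x ∈ atom W S)
    (hT : x ∈ atom W T) : S = T := by
  ext k; rw [← hS.2 k, hT.2 k]

theorem disjoint_atom {S T : Finset (Fin n)} (h : S ≠ T) : Disjoint (atom W S) (atom W T) :=
  Set.disjoint_left.2 fun _ hS hT => h (eq_of_mem_atom hS hT)

theorem exists_mem_atom {k : Fin n} {x : Plane} (hx : x ∈ W k) :
    ∃ T, k ∈ T ∧ x ∈ atom W T := by
  classical
  exact ⟨Finset.univ.filter fun j => x ∈ W j, by simpa using hx, ⟨k, by simpa using hx⟩, by simp⟩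

/-- Some `W k` with `k ∈ T` has all its points of `χ` in the atom of `T`. -/
def OnlyInAtom (W : Fin n → Set Plane) (χ : Set Plane) (T : Finset (Fin n)) : Prop :=
  ∃ k ∈ T, ∀ S, S ≠ T → k ∈ S → χ ∩ atom W S = ∅

theorem OnlyInAtom.inter_eq {χ : Set Plane} {T : Finset (Fin n)} (h : OnlyInAtom W χ T) :
    ∃ k ∈ T, χ ∩ W k = χ ∩ atom W T := by
  obtain ⟨k, hk, hS⟩ := h
  refine ⟨k, hk, Set.Subset.antisymm (fun x hx => ?_)
    (Set.inter_subset_inter_right _ (atom_subset hk))⟩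
  obtain ⟨S, hkS, hxS⟩ := exists_mem_atom hx.2
  by_cases hST : S = T
  · exact ⟨hx.1, hST ▸ hxS⟩
  · exact absurd (show x ∈ χ ∩ atom W S from ⟨hx.1, hxS⟩) (by simp [hS S hST hkS])

/-- If `W k` has `x` as its only point and `x` lies in the atom of `T`, then `k ∈ T` and the other
atoms inside `W k` are empty. The indicator on `Unit` merely encodes 0 or 1. -/
theorem singleton_inter_atom {χ : Set Plane} (T : Finset (Fin n)) :
    ({x | ∃ k, χ ∩ W k = {x}} ∩ atom W T).encard =
      {_x : Unit | (χ ∩ atom W T).encard = 1 ∧ OnlyInAtom W χ T}.indicator 1 () := by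
  by_cases h : (χ ∩ atom W T).encard = 1 ∧ OnlyInAtom W χ T
  · obtain ⟨x, hx⟩ := Set.encard_eq_one.1 h.1
    obtain ⟨k, hk, hkT⟩ := h.2.inter_eq
    have hxT : x ∈ χ ∩ atom W T := hx ▸ rfl
    have : {x | ∃ k, χ ∩ W k = {x}} ∩ atom W T = {x} := by
      refine Set.eq_singleton_iff_unique_mem.2 ⟨⟨⟨k, hkT.trans hx⟩, hxT.2⟩, ?_⟩
      rintro y ⟨⟨j, hj⟩, hyT⟩
      have hy : y ∈ χ ∩ W j := hj ▸ rfl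
      have : y ∈ χ ∩ atom W T := ⟨hy.1, hyT⟩
      rwa [hx] at this
    rw [this, Set.encard_singleton, Set.indicator_of_mem (by exact h)]
    rfl
  · rw [Set.indicator_of_notMem (by exact h), Set.encard_eq_zero, Set.eq_empty_iff_forall_notMem]
    rintro x ⟨⟨k, hk⟩, hxT⟩
    have hx : x ∈ χ ∩ W k := hk ▸ rfl
    have hkT : k ∈ T := (hxT.2 k).1 hx.2
    refine h ⟨Set.encard_eq_one.2 ⟨x, ?_⟩, k, hkT, fun S hS hkS => ?_⟩
    · refine Set.Subset.antisymm ?_ (by simpa using ⟨hx.1, hxT⟩)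
      rw [← hk]; exact Set.inter_subset_inter_right _ (atom_subset hkT)
    · rw [Set.eq_empty_iff_forall_notMem]
      intro y hy
      have : y ∈ χ ∩ W k := ⟨hy.1, atom_subset hkS hy.2⟩
      rw [hk] at this
      obtain rfl : y = x := this
      exact hS (eq_of_mem_atom hy.2 hxT)

theorem empty_inter_atom {χ : Set Plane} (T : Finset (Fin n)) :
    ({x | ∃ k, x ∈ W k ∧ χ ∩ W k = ∅} ∩ atom W T) =
      {x | x ∈ atom W T ∧ χ ∩ atom W T = ∅ ∧ OnlyInAtom W χ T} := by
  ext x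
  constructor
  · rintro ⟨⟨k, hxk, hk⟩, hxT⟩
    have hS : ∀ S, k ∈ S → χ ∩ atom W S = ∅ := fun S hkS =>
      Set.subset_eq_empty (Set.inter_subset_inter_right _ (atom_subset hkS)) hk
    have hkT := (hxT.2 k).1 hxk
    exact ⟨hxT, hS T hkT, k, hkT, fun S _ => hS S⟩
  · rintro ⟨hxT, h0, h⟩
    obtain ⟨k, hk, hkT⟩ := h.inter_eq
    exact ⟨⟨k, atom_subset hk hxT, hkT.trans h0⟩, hxT⟩

theorem measure_eq_sum_atom (ν : Measure Plane) {S : Set Plane}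
    (hS : ∀ x ∈ S, ∃ k, x ∈ W k) (hm : ∀ T, MeasurableSet (S ∩ atom W T)) :
    ν S = ∑ T, ν (S ∩ atom W T) := by
  rw [← measure_biUnion_finset (s := Finset.univ) (f := fun T => S ∩ atom W T)
    (fun T _ T' _ h => (disjoint_atom h).mono Set.inter_subset_right Set.inter_subset_right)
    fun T _ => hm T]
  congr 1
  ext x
  simp only [Finset.mem_univ, Set.iUnion_true, Set.mem_iUnion, Set.mem_inter_iff]
  refine ⟨fun hx => ?_, fun ⟨_, hx⟩ => hx.1⟩
  obtain ⟨k, hk⟩ := hS x hx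
  obtain ⟨T, -, hT⟩ := exists_mem_atom hk
  exact ⟨T, hx, hT⟩

end atoms

/-- `OnlyInAtom W χ T` depends only on the counts in atoms other than that of `T`, hence is
independent of the count there. -/
theorem IsPoissonProcess.prob_atom (hX : IsPoissonProcess P l X) {n : ℕ} {W : Fin n → Set Plane}
    (hW : ∀ k, MeasurableSet (W k)) (hb : ∀ k, Bornology.IsBounded (W k)) (T : Finset (Fin n)) :
    MeasurableSet {ω | OnlyInAtom W (X ω) T} ∧ ∀ c : ℕ,
      P ({ω | (X ω ∩ atom W T).ncard = c} ∩ {ω | OnlyInAtom W (X ω) T}) =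
        P {ω | (X ω ∩ atom W T).ncard = c} * P {ω | OnlyInAtom W (X ω) T} := by
  classical
  have hmeas : ∀ S, Measurable fun ω => (X ω ∩ atom W S).ncard := fun S =>
    hX.measurable_count _ (measurableSet_atom hW S) (isBounded_atom hb S)
  have hind := hX.iIndepFun_count (fun T => measurableSet_atom hW T) (fun T => isBounded_atom hb T)
    fun S T h => disjoint_atom (W := W) h
  have h2 := hind.indepFun_finset {T} (Finset.univ.erase T) (by simp) hmeas
  set V : Set (↥(Finset.univ.erase T) → ℕ) :=
    {v | ∃ k ∈ T, ∀ S : ↥(Finset.univ.erase T), k ∈ S.1 → v S = 0} with hV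
  have hVm : MeasurableSet V := (Set.to_countable V).measurableSet
  have hpre : {ω | OnlyInAtom W (X ω) T} =
      (fun ω (S : ↥(Finset.univ.erase T)) => (X ω ∩ atom W S.1).ncard) ⁻¹' V := by
    ext ω
    simp only [OnlyInAtom, hV, Set.mem_ofPred_eq, Set.mem_preimage]
    refine exists_congr fun k => and_congr_right fun _ => ?_
    simp [hX.ncard_eq_zero (isBounded_atom hb _) ω]
  refine ⟨hpre ▸ (measurable_pi_lambda _ fun S => hmeas _) hVm, fun c => ?_⟩
  have h3 := h2.measure_inter_preimage_eq_mul {v | v ⟨T, by simp⟩ = c} V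
    (Set.to_countable _).measurableSet hVm
  rw [← hpre] at h3
  exact h3

/-- On each atom both sides carry the same factor `P (OnlyInAtom ...)`; what remains is `P(1) = m
P(0)`, with `m` equal to `l` times the area of the atom. -/
theorem IsPoissonProcess.finite_mecke (hX : IsPoissonProcess P l X) (hl : 0 < l) {n : ℕ}
    {W : Fin n → Set Plane} (hW : ∀ k, MeasurableSet (W k))
    (hb : ∀ k, Bornology.IsBounded (W k)) :
    (Measurable fun ω => Measure.count {x | ∃ k, X ω ∩ W k = {x}}) ∧
    (Measurable fun ω => volume {x | ∃ k, x ∈ W k ∧ X ω ∩ W k = ∅}) ∧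
    ∫⁻ ω, Measure.count {x | ∃ k, X ω ∩ W k = {x}} ∂P =
      ENNReal.ofReal l * ∫⁻ ω, volume {x | ∃ k, x ∈ W k ∧ X ω ∩ W k = ∅} ∂P := by
  classical
  have hmeas : ∀ T c, MeasurableSet {ω | (X ω ∩ atom W T).ncard = c} := fun T c =>
    hX.measurable_count _ (measurableSet_atom hW T) (isBounded_atom hb T)
      (measurableSet_singleton c)
  have hprob := fun T => hX.prob_atom hW hb T
  have h1 : (fun ω => Measure.count {x | ∃ k, X ω ∩ W k = {x}}) = fun ω =>
      ∑ T, ({ω | (X ω ∩ atom W T).ncard = 1} ∩ {ω | OnlyInAtom W (X ω) T}).indicator 1 ω := by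
    ext ω
    have hfin : {x | ∃ k, X ω ∩ W k = {x}}.Finite := by
      refine (Set.finite_iUnion fun k => hX.locallyFinite ω (W k) (hb k)).subset ?_
      rintro x ⟨k, hk⟩
      exact Set.mem_iUnion.2 ⟨k, hk ▸ rfl⟩
    have hsub : ∀ T, ({x | ∃ k, X ω ∩ W k = {x}} ∩ atom W T).Finite := fun T =>
      hfin.subset Set.inter_subset_left
    rw [measure_eq_sum_atom (W := W) Measure.count ?_ fun T => (hsub T).measurableSet]
    · refine Finset.sum_congr rfl fun T _ => ?_
      rw [Measure.count_apply (hsub T).measurableSet, singleton_inter_atom]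
      have : (X ω ∩ atom W T).encard = 1 ↔ (X ω ∩ atom W T).ncard = 1 := by
        rw [Set.ncard_eq_one, Set.encard_eq_one]
      by_cases h : (X ω ∩ atom W T).ncard = 1 ∧ OnlyInAtom W (X ω) T
      · rw [Set.indicator_of_mem (by simpa [this] using h), Set.indicator_of_mem (by exact h)]
        simp
      · rw [Set.indicator_of_notMem (by simpa [this] using h), Set.indicator_of_notMem (by exact h)]
        simp
    · rintro x ⟨k, hk⟩
      have hx : x ∈ X ω ∩ W k := hk ▸ rfl
      exact ⟨k, hx.2⟩
  have h2 : (fun ω => volume {x | ∃ k, x ∈ W k ∧ X ω ∩ W k = ∅}) = fun ω =>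
      ∑ T, ({ω | (X ω ∩ atom W T).ncard = 0} ∩ {ω | OnlyInAtom W (X ω) T}).indicator
        (fun _ => volume (atom W T)) ω := by
    ext ω
    rw [measure_eq_sum_atom (W := W) volume ?_ fun T => ?_]
    · refine Finset.sum_congr rfl fun T _ => ?_
      rw [empty_inter_atom]
      by_cases h : X ω ∩ atom W T = ∅ ∧ OnlyInAtom W (X ω) T
      · rw [Set.indicator_of_mem (show ω ∈ {ω | (X ω ∩ atom W T).ncard = 0} ∩
          {ω | OnlyInAtom W (X ω) T} from ⟨(hX.ncard_eq_zero (isBounded_atom hb T) ω).2 h.1, h.2⟩)]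
        simp [h]
      · rw [Set.indicator_of_notMem fun h' =>
          h ⟨(hX.ncard_eq_zero (isBounded_atom hb T) ω).1 h'.1, h'.2⟩]
        simp [h]
    · rintro x ⟨k, hk, -⟩
      exact ⟨k, hk⟩
    · rw [empty_inter_atom]
      exact (measurableSet_atom hW T).inter (MeasurableSet.const _)
  rw [h1, h2]
  refine ⟨Finset.measurable_fun_sum _ fun T _ =>
    measurable_one.indicator ((hmeas T 1).inter (hprob T).1), Finset.measurable_fun_sum _ fun T _ =>
    measurable_const.indicator ((hmeas T 0).inter (hprob T).1), ?_⟩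
  rw [lintegral_finsetSum _ fun T _ =>
    measurable_one.indicator ((hmeas T 1).inter (hprob T).1), lintegral_finsetSum _ fun T _ =>
    measurable_const.indicator ((hmeas T 0).inter (hprob T).1), Finset.mul_sum]
  refine Finset.sum_congr rfl fun T _ => ?_
  rw [lintegral_indicator_one ((hmeas T 1).inter (hprob T).1),
    lintegral_indicator_const ((hmeas T 0).inter (hprob T).1), (hprob T).2, (hprob T).2,
    hX.prob_ncard_eq_one hl (measurableSet_atom hW T) (isBounded_atom hb T)]
  ring

theorem IsPoissonProcess.mecke (hX : IsPoissonProcess P l X) (hl : 0 < l)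
    {W : ℕ → Set Plane} (hW : ∀ k, MeasurableSet (W k))
    (hb : ∀ k, Bornology.IsBounded (W k)) :
    (Measurable fun ω => Measure.count {x | ∃ k, X ω ∩ W k = {x}}) ∧
    (Measurable fun ω => volume {x | ∃ k, x ∈ W k ∧ X ω ∩ W k = ∅}) ∧
    ∫⁻ ω, Measure.count {x | ∃ k, X ω ∩ W k = {x}} ∂P =
      ENNReal.ofReal l * ∫⁻ ω, volume {x | ∃ k, x ∈ W k ∧ X ω ∩ W k = ∅} ∂P := by
  have hfin := fun n : ℕ => hX.finite_mecke hl (W := fun k : Fin n => W k) (fun k => hW k)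
    fun k => hb k
  have hsup : ∀ (ν : Measure Plane) (p : Plane → ℕ → Prop),
      ν {x | ∃ k, p x k} = ⨆ n : ℕ, ν {x | ∃ k : Fin n, p x k} := by
    intro ν p
    rw [← Monotone.measure_iUnion]
    · congr 1
      ext x
      simp only [Set.mem_ofPred_eq, Set.mem_iUnion]
      exact ⟨fun ⟨k, hk⟩ => ⟨k + 1, ⟨k, by simp⟩, hk⟩, fun ⟨_, k, hk⟩ => ⟨k, hk⟩⟩
    · rintro m n hmn x ⟨k, hk⟩
      exact ⟨Fin.castLE hmn k, hk⟩
  have hmono : ∀ (ν : Measure Plane) (p : Ω → Plane → ℕ → Prop),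
      Monotone fun (n : ℕ) ω => ν {x | ∃ k : Fin n, p ω x k} := by
    intro ν p m n hmn ω
    refine measure_mono ?_
    rintro x ⟨k, hk⟩
    exact ⟨Fin.castLE hmn k, hk⟩
  have h1 := fun ω => hsup Measure.count fun x k => X ω ∩ W k = {x}
  have h2 := fun ω => hsup volume fun x k => x ∈ W k ∧ X ω ∩ W k = ∅
  simp only [h1, h2]
  refine ⟨.iSup fun n => (hfin n).1, .iSup fun n => (hfin n).2.1, ?_⟩
  rw [lintegral_iSup (fun n => (hfin n).1) (hmono Measure.count fun ω x k => X ω ∩ W k = {x}),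
    lintegral_iSup (fun n => (hfin n).2.1) (hmono volume fun ω x k => x ∈ W k ∧ X ω ∩ W k = ∅),
    ENNReal.mul_iSup]
  exact iSup_congr fun n => (hfin n).2.2

end Poisson

/-! ### Support functions and the area of a flower in polar coordinates -/

theorem continuous_unitVec : Continuous unitVec := by
  unfold unitVec; fun_prop

theorem supportFun_eq (L : Set Plane) (z : Plane) :
    supportFun 0 L z = sSup ((fun y : Plane => inner ℝ y z) '' L) := by
  simp [supportFun]

theorem bddAbove_inner_image {L : Set Plane} (hL : Bornology.IsBounded L) (z : Plane) :
    BddAbove ((fun y : Plane => (inner ℝ y z : ℝ)) '' L) := by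
  obtain ⟨R, hR⟩ := hL.exists_norm_le
  refine ⟨R * ‖z‖, ?_⟩
  rintro _ ⟨y, hy, rfl⟩
  exact (real_inner_le_norm y z).trans (by gcongr; exact hR y hy)

theorem inner_le_supportFun {L : Set Plane} (hL : Bornology.IsBounded L) {y : Plane} (hy : y ∈ L)
    (z : Plane) : inner ℝ y z ≤ supportFun 0 L z := by
  rw [supportFun_eq]
  exact le_csSup (bddAbove_inner_image hL z) ⟨y, hy, rfl⟩

theorem supportFun_le {L : Set Plane} (hL : L.Nonempty) {z : Plane} {c : ℝ}
    (h : ∀ y ∈ L, inner ℝ y z ≤ c) : supportFun 0 L z ≤ c := by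
  rw [supportFun_eq]
  refine csSup_le (hL.image _) ?_
  rintro _ ⟨y, hy, rfl⟩
  exact h y hy

theorem supportFun_nonneg {L : Set Plane} (hL : Bornology.IsBounded L) (h0 : (0 : Plane) ∈ L)
    (z : Plane) : 0 ≤ supportFun 0 L z := by
  simpa using inner_le_supportFun hL h0 z

theorem supportFun_mono {L M : Set Plane} (hL : L.Nonempty) (hM : Bornology.IsBounded M)
    (h : L ⊆ M) (z : Plane) : supportFun 0 L z ≤ supportFun 0 M z :=
  supportFun_le hL fun _ hy => inner_le_supportFun hM (h hy) z

theorem supportFun_le_mul {L M : Set Plane} (hL : L.Nonempty) (hM : Bornology.IsBounded M) {r : ℝ}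
    (hr : 0 ≤ r) (h : L ⊆ r • M) (z : Plane) : supportFun 0 L z ≤ r * supportFun 0 M z := by
  refine supportFun_le hL fun y hy => ?_
  obtain ⟨x, hx, rfl⟩ := h hy
  rw [real_inner_smul_left]
  exact mul_le_mul_of_nonneg_left (inner_le_supportFun hM hx z) hr

theorem continuous_supportFun {L : Set Plane} (hL : IsCompact L) :
    Continuous (supportFun 0 L) := by
  have : supportFun 0 L = fun z => sSup ((fun y : Plane => (inner ℝ y z : ℝ)) '' L) :=
    funext (supportFun_eq L)
  rw [this]
  exact hL.continuous_sSup (f := fun z y : Plane => (inner ℝ y z : ℝ)) (by fun_prop)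

theorem norm_unitVec (θ : ℝ) : ‖unitVec θ‖ = 1 := by
  have h : ‖unitVec θ‖ ^ 2 = 1 := by
    rw [← real_inner_self_eq_norm_sq, inner_eq]
    simp only [unitVec, PiLp.toLp_apply, Matrix.cons_val_zero, Matrix.cons_val_one]
    linarith [Real.sin_sq_add_cos_sq θ]
  nlinarith [norm_nonneg (unitVec θ)]

/-- The support function is the radial function of the flower; compactness makes the supremum
attained. -/
theorem smul_unitVec_mem_flower {L : Set Plane} (hL : IsCompact L) (hne : L.Nonempty) {r θ : ℝ}
    (hr : 0 < r) : r • unitVec θ ∈ flower 0 L ↔ r ≤ supportFun 0 L (unitVec θ) := by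
  rw [mem_flower]
  simp only [norm_smul, norm_unitVec, Real.norm_of_nonneg hr.le, inner_smul_right, mul_one, pow_two,
    mul_le_mul_iff_right₀ hr]
  constructor
  · rintro ⟨s, hs, h⟩
    exact h.trans (inner_le_supportFun hL.isBounded hs _)
  · intro h
    have hc : IsCompact ((fun y : Plane => (inner ℝ y (unitVec θ) : ℝ)) '' L) :=
      hL.image (by fun_prop)
    obtain ⟨s, hs, h'⟩ := hc.sSup_mem (hne.image _)
    refine ⟨s, hs, ?_⟩
    rw [supportFun_eq, ← h'] at h
    exact h

theorem volume_eq_lintegral_polar {S : Set Plane} (hS : MeasurableSet S) :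
    volume S = ∫⁻ θ in Set.Ioo (-Real.pi) Real.pi, ∫⁻ r in Set.Ioi (0 : ℝ),
      ENNReal.ofReal r * S.indicator 1 (r • unitVec θ) := by
  have hmp := ((volume_preserving_finTwoArrow ℝ).symm).trans
    (EuclideanSpace.volume_preserving_symm_measurableEquiv_toLp (Fin 2)).symm
  have hval : ∀ p : ℝ × ℝ, (MeasurableEquiv.finTwoArrow.symm.trans
      (MeasurableEquiv.toLp 2 (Fin 2 → ℝ)).symm.symm) (polarCoord.symm p) = p.1 • unitVec p.2 := by
    intro p
    ext i
    fin_cases i <;> simp [polarCoord, unitVec, MeasurableEquiv.finTwoArrow, MeasurableEquiv.toLp] <;> rfl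
  set e := MeasurableEquiv.finTwoArrow.symm.trans
    (MeasurableEquiv.toLp 2 (Fin 2 → ℝ)).symm.symm
  have hmeas : Measurable (S.indicator (1 : Plane → ENNReal)) := measurable_one.indicator hS
  have h1 : volume S = ∫⁻ p : ℝ × ℝ, S.indicator 1 (e p) := by
    rw [← lintegral_indicator_one hS]
    exact (hmp.lintegral_comp hmeas).symm
  rw [h1, ← lintegral_comp_polarCoord_symm]
  simp only [hval, polarCoord_target]
  rw [Measure.volume_eq_prod, ← Measure.prod_restrict, lintegral_prod_symm]
  · rfl
  · refine Measurable.aemeasurable ?_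
    refine (ENNReal.measurable_ofReal.comp measurable_fst).smul (hmeas.comp ?_)
    have : Continuous fun p : ℝ × ℝ => p.1 • unitVec p.2 :=
      continuous_fst.smul (continuous_unitVec.comp continuous_snd)
    exact this.measurable

theorem lintegral_Ioc_ofReal {p : ℝ} (hp : 0 ≤ p) :
    ∫⁻ r in Set.Ioc 0 p, ENNReal.ofReal r = ENNReal.ofReal (p ^ 2 / 2) := by
  rw [← ofReal_integral_eq_lintegral_ofReal, ← intervalIntegral.integral_of_le hp]
  · congr 1
    simp
  · exact (intervalIntegrable_iff_integrableOn_Ioc_of_le hp).1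
      (continuous_id.intervalIntegrable _ _)
  · filter_upwards [ae_restrict_mem measurableSet_Ioc] with r hr using hr.1.le

theorem area_flower {L : Set Plane} (hL : IsCompact L) (h0 : (0 : Plane) ∈ L) :
    area (flower 0 L) = ∫ θ in (0 : ℝ)..(2 * Real.pi), supportFun 0 L (unitVec θ) ^ 2 / 2 := by
  have hc : Continuous fun θ => supportFun 0 L (unitVec θ) :=
    (continuous_supportFun hL).comp continuous_unitVec
  have hper : Function.Periodic (fun θ => supportFun 0 L (unitVec θ) ^ 2 / 2) (2 * Real.pi) :=
    fun θ => by simp [unitVec]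
  have h1 : volume (flower 0 L) =
      ∫⁻ θ in Set.Ioo (-Real.pi) Real.pi, ENNReal.ofReal (supportFun 0 L (unitVec θ) ^ 2 / 2) := by
    rw [volume_eq_lintegral_polar (isClosed_flower hL).measurableSet]
    refine lintegral_congr fun θ => ?_
    have hp := supportFun_nonneg hL.isBounded h0 (unitVec θ)
    rw [← lintegral_Ioc_ofReal hp, ← Set.Ioi_inter_Iic, ← lintegral_indicator measurableSet_Ioi,
      ← lintegral_indicator (measurableSet_Ioi.inter measurableSet_Iic)]
    refine lintegral_congr fun r => ?_
    by_cases hr : 0 < r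
    · rw [Set.indicator_of_mem (by exact hr)]
      by_cases hr' : r ≤ supportFun 0 L (unitVec θ)
      · rw [Set.indicator_of_mem ((smul_unitVec_mem_flower hL ⟨0, h0⟩ hr).2 hr'),
          Set.indicator_of_mem (by exact ⟨hr, hr'⟩)]
        simp
      · rw [Set.indicator_of_notMem (fun h => hr' ((smul_unitVec_mem_flower hL ⟨0, h0⟩ hr).1 h)),
          Set.indicator_of_notMem (by exact fun h => hr' h.2)]
        simp
    · rw [Set.indicator_of_notMem (by exact hr), Set.indicator_of_notMem (by exact fun h => hr h.1)]
  have h2 := hper.intervalIntegral_add_eq 0 (-Real.pi)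
  rw [zero_add] at h2
  rw [area, Measure.real, h1, h2, setLIntegral_congr Ioo_ae_eq_Ioc,
    show -Real.pi + 2 * Real.pi = Real.pi by ring,
    intervalIntegral.integral_of_le (by linarith [Real.pi_pos]), integral_eq_lintegral_of_nonneg_ae]
  · exact Eventually.of_forall fun θ => by positivity
  · exact (hc.pow 2 |>.div_const 2).aestronglyMeasurable

/-! ### Tail bounds for the size of the cell -/

/-- The points of the open disk around `y` through the origin outside twice the flower of `K`. -/
def testSet (K : Set Plane) (y : Plane) : Set Plane :=
  Metric.ball y ‖y‖ \ ((2 : ℝ) • flower 0 K)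

theorem inter_testSet (K χ : Set Plane) (y : Plane) :
    χ ∩ testSet K y = (χ ∩ ((2 : ℝ) • flower 0 K)ᶜ) ∩ Metric.ball y ‖y‖ := by
  rw [testSet, Set.sdiff_eq]
  ext; simp only [Set.mem_inter_iff]; tauto

theorem mem_cellAround {K χ : Set Plane} {y : Plane} :
    y ∈ cellAround K χ ↔ χ ∩ testSet K y = ∅ := by
  rw [cellAround_eq, inter_testSet]; rfl

theorem measurableSet_testSet {K : Set Plane} (hK : IsCompact K) (y : Plane) :
    MeasurableSet (testSet K y) :=
  measurableSet_ball.diff (isClosed_two_smul_flower hK).measurableSet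

theorem isBounded_testSet (K : Set Plane) (y : Plane) : Bornology.IsBounded (testSet K y) :=
  Metric.isBounded_ball.subset Set.sdiff_subset

/-- Separate `y` from `K` by a line and reflect the origin in it: the image is closer to `y` than
the origin is, but farther from every point of `K`. The last inequality keeps the ball inside the
open disk of `y` and is an open condition on `y`, as the compactness argument below requires. -/
theorem exists_closedBall_subset_testSet {K : Set Plane} (hc : Convex ℝ K) (hk : IsCompact K)
    (h0 : (0 : Plane) ∈ K) {y : Plane} (hy : y ∉ K) :
    ∃ p : Plane × ℝ, 0 < p.2 ∧ Disjoint (Metric.closedBall p.1 p.2) ((2 : ℝ) • flower 0 K) ∧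
      p.2 + ‖p.1 - y‖ < ‖y‖ := by
  obtain ⟨f, u, hfu, huy⟩ := geometric_hahn_banach_closed_point hc hk.isClosed hy
  set v := (InnerProductSpace.toDual ℝ Plane).symm f with hv
  have hf : ∀ x, f x = inner ℝ v x := fun x => by simp [hv]
  have hu : 0 < u := by simpa using hfu 0 h0
  have hv0 : v ≠ 0 := by
    intro h
    rw [hf, h, inner_zero_left] at huy
    linarith
  have hvn : 0 < ‖v‖ ^ 2 := by positivity
  -- The mirror image of the origin in the line `f = u`.
  set z : Plane := (2 * u / ‖v‖ ^ 2) • v with hz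
  have hzn : ‖z‖ ^ 2 = 2 * (2 * u / ‖v‖ ^ 2) * u := by
    rw [hz, norm_smul, mul_pow, Real.norm_of_nonneg (by positivity)]
    field_simp
  have hzi : ∀ x, inner ℝ x z = (2 * u / ‖v‖ ^ 2) * f x := fun x => by
    rw [hz, inner_smul_right, hf, real_inner_comm]
  have hpos : 0 < 2 * u / ‖v‖ ^ 2 := by positivity
  have hzy : ‖z - y‖ < ‖y‖ := by
    rw [← mem_ball_iff_norm, mem_ball_norm_iff, hzn, hzi]
    nlinarith
  have hzF : z ∉ (2 : ℝ) • flower 0 K := by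
    rw [mem_two_smul_flower]
    rintro ⟨s, hs, h⟩
    rw [hzn, hzi] at h
    nlinarith [hfu s hs]
  obtain ⟨δ, hδ, hδF⟩ := Metric.isOpen_iff.1 (isClosed_two_smul_flower hk).isOpen_compl z hzF
  have hm : 0 < min δ (‖y‖ - ‖z - y‖) := lt_min hδ (by linarith)
  refine ⟨(z, min δ (‖y‖ - ‖z - y‖) / 2), by positivity, ?_, ?_⟩
  · rw [← Set.subset_compl_iff_disjoint_right]
    refine (Metric.closedBall_subset_ball ?_).trans hδF
    linarith [min_le_left δ (‖y‖ - ‖z - y‖)]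
  · linarith [min_le_right δ (‖y‖ - ‖z - y‖)]

theorem mem_smul_of_gauge_le {K : Set Plane} (hc : Convex ℝ K) (hk : IsCompact K)
    (h0 : (0 : Plane) ∈ interior K) {c : ℝ} (hcpos : 0 < c) {y : Plane} (h : gauge K y ≤ c) :
    y ∈ c • K := by
  rw [Set.mem_smul_set_iff_inv_smul_mem₀ hcpos.ne', ← hk.isClosed.closure_eq,
    ← gauge_le_one_iff_mem_closure hc (mem_interior_iff_mem_nhds.1 h0),
    gauge_smul_of_nonneg (by positivity), smul_eq_mul, inv_mul_le_one₀ hcpos]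
  exact h

/-- Compactness of the curve `gauge K = 1 + ε` yields finitely many balls, which are then scaled by
`r`. A cell leaving `(r * (1 + ε)) • K` contains, along the ray to an outside point, a point of
gauge exactly `r * (1 + ε)`, whose nucleus-free test set contains a scaled ball. -/
theorem exists_finset_empty_closedBall {K : Set Plane} (hc : Convex ℝ K) (hk : IsCompact K)
    (h0 : (0 : Plane) ∈ interior K) {ε : ℝ} (hε : 0 < ε) :
    ∃ Z : Finset (Plane × ℝ), (∀ p ∈ Z, 0 < p.2) ∧ ∀ r : ℝ, 1 ≤ r → ∀ χ : Set Plane,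
      ¬ cellAround K χ ⊆ (r * (1 + ε)) • K →
        ∃ p ∈ Z, χ ∩ Metric.closedBall (r • p.1) (r * p.2) = ∅ := by
  classical
  have hK0 : (0 : Plane) ∈ K := interior_subset h0
  have hnhds : K ∈ 𝓝 (0 : Plane) := mem_interior_iff_mem_nhds.1 h0
  set C := {y : Plane | gauge K y = 1 + ε} with hC
  have hCk : IsCompact C := by
    refine (hk.smul (1 + ε)).of_isClosed_subset
      (isClosed_eq (continuous_gauge hc hnhds) continuous_const) fun y hy => ?_
    exact mem_smul_of_gauge_le hc hk h0 (by linarith) (le_of_eq hy)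
  have hCK : ∀ y ∈ C, y ∉ K := fun y hy hyK => by
    have := gauge_le_one_of_mem hyK
    rw [show gauge K y = 1 + ε from hy] at this
    linarith
  choose! f hf1 hf2 hf3 using fun y (hy : y ∈ C) =>
    exists_closedBall_subset_testSet hc hk hK0 (hCK y hy)
  obtain ⟨t, htC, ht⟩ := hCk.elim_nhds_subcover
    (fun y => {y' | (f y).2 + ‖(f y).1 - y'‖ < ‖y'‖}) fun y hy =>
      (isOpen_lt (by fun_prop) (by fun_prop)).mem_nhds (hf3 y hy)
  refine ⟨t.image f, ?_, fun r hr χ hχ => ?_⟩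
  · simp only [Finset.mem_image]
    rintro _ ⟨y, hy, rfl⟩
    exact hf1 y (htC y hy)
  · have hr0 : 0 < r := by linarith
    obtain ⟨y, hy, hyK⟩ := Set.not_subset.1 hχ
    have hg : r * (1 + ε) < gauge K y := by
      by_contra! h
      exact hyK (mem_smul_of_gauge_le hc hk h0 (by positivity) h)
    have hg0 : 0 < gauge K y := lt_trans (by positivity) hg
    set y' : Plane := (r * (1 + ε) / gauge K y) • y with hy'
    have hy'c : y' ∈ cellAround K χ := by
      rw [cellAround_eq] at hy ⊢
      exact smul_mem_emptyCell hy (by positivity) ((div_le_one hg0).2 hg.le)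
    have hyC : r⁻¹ • y' ∈ C := by
      show gauge K (r⁻¹ • y') = 1 + ε
      rw [hy', gauge_smul_of_nonneg (by positivity), gauge_smul_of_nonneg (by positivity)]
      simp only [smul_eq_mul]
      field_simp
    obtain ⟨w, hwt, hw⟩ := Set.mem_iUnion₂.1 (ht hyC)
    have hw' : (f w).2 + ‖(f w).1 - r⁻¹ • y'‖ < ‖r⁻¹ • y'‖ := hw
    refine ⟨f w, Finset.mem_image_of_mem f hwt, ?_⟩
    refine Set.subset_eq_empty (Set.inter_subset_inter_right _ fun x hx => ?_)
      (mem_cellAround.1 hy'c)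
    have hyr : y' = r • (r⁻¹ • y') := (smul_inv_smul₀ hr0.ne' y').symm
    have hxr : x = r • (r⁻¹ • x) := (smul_inv_smul₀ hr0.ne' x).symm
    set x₀ := r⁻¹ • x
    set y₀ := r⁻¹ • y'
    have hx₀ : x₀ ∈ Metric.closedBall (f w).1 (f w).2 := by
      rw [mem_closedBall_iff_norm, hxr, ← smul_sub, norm_smul, Real.norm_of_nonneg hr0.le] at hx
      rw [mem_closedBall_iff_norm]
      exact le_of_mul_le_mul_left hx hr0
    refine ⟨?_, fun hxF => ?_⟩
    · rw [mem_ball_iff_norm, hxr, hyr, ← smul_sub, norm_smul, norm_smul]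
      refine mul_lt_mul_of_pos_left ?_ (norm_pos_iff.2 hr0.ne')
      calc ‖x₀ - y₀‖ = ‖(x₀ - (f w).1) + ((f w).1 - y₀)‖ := by congr 1; abel
        _ ≤ ‖x₀ - (f w).1‖ + ‖(f w).1 - y₀‖ := norm_add_le _ _
        _ ≤ (f w).2 + ‖(f w).1 - y₀‖ := by gcongr; exact mem_closedBall_iff_norm.1 hx₀
        _ < ‖y₀‖ := hw'
    · refine Set.disjoint_left.1 (hf2 w (htC w hwt)) hx₀ ?_
      rw [mem_two_smul_flower] at hxF ⊢
      obtain ⟨s, hs, h⟩ := hxF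
      -- Since `r ≥ 1` and `K` is star-shaped about 0, `K` contains `r⁻¹ • s`.
      refine ⟨r⁻¹ • s, hc.smul_mem_of_zero_mem hK0 hs ⟨by positivity, inv_le_one_of_one_le₀ hr⟩, ?_⟩
      rw [hxr, norm_smul, Real.norm_of_nonneg hr0.le, inner_smul_right] at h
      rw [real_inner_smul_left]
      have : ‖x₀‖ ^ 2 = r⁻¹ * (r⁻¹ * (r * ‖x₀‖) ^ 2) := by field_simp
      rw [this]
      calc r⁻¹ * (r⁻¹ * (r * ‖x₀‖) ^ 2) ≤ r⁻¹ * (r⁻¹ * (2 * (r * inner ℝ s x₀))) := by gcongr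
        _ = 2 * (r⁻¹ * inner ℝ s x₀) := by field_simp

/-- This polynomial bound is enough: with `x` of order `l * r ^ 2` it gives `l⁻² r⁻⁴`, still
summable against the weight `r ^ 2`. -/
theorem exp_neg_le_two_div_sq {x : ℝ} (hx : 0 < x) : Real.exp (-x) ≤ 2 / x ^ 2 := by
  rw [Real.exp_neg, inv_le_comm₀ (Real.exp_pos x) (by positivity), inv_div]
  linarith [Real.quadratic_le_exp_of_nonneg hx.le]

section Poisson

variable {Ω : Type*} [MeasurableSpace Ω] {P : Measure Ω} {l : ℝ} {X : Ω → Set Plane}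

theorem IsPoissonProcess.prob_closedBall_le (hX : IsPoissonProcess P l X) (hl : 0 < l) {r : ℝ}
    (hr : 0 < r) (p : Plane × ℝ) (hp : 0 < p.2) :
    P {ω | X ω ∩ Metric.closedBall (r • p.1) (r * p.2) = ∅} ≤
      ENNReal.ofReal (2 / (p.2 ^ 2 * volume.real (Metric.ball (0 : Plane) 1)) ^ 2 /
        (l ^ 2 * r ^ 4)) := by
  have hv : 0 < volume.real (Metric.ball (0 : Plane) 1) :=
    ENNReal.toReal_pos (Metric.measure_ball_pos _ _ one_pos).ne' measure_ball_lt_top.ne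
  rw [hX.prob_inter_eq_empty hl measurableSet_closedBall Metric.isBounded_closedBall,
    Measure.addHaar_real_closedBall _ _ (by positivity)]
  refine ENNReal.ofReal_le_ofReal ((exp_neg_le_two_div_sq (by positivity)).trans (le_of_eq ?_))
  simp only [finrank_euclideanSpace, Fintype.card_fin]
  field_simp

/-- `E j` is the event that some ball of scale `j + 1` is empty. The first `j` outside it gives `r =
(j + 1) * (1 + ε)`, and `G` sums squared radii over the events that occur. `C` does not depend on
`l`. -/
theorem exists_envelope {K : Set Plane} (hc : Convex ℝ K) (hk : IsCompact K)
    (h0 : (0 : Plane) ∈ interior K) {ε : ℝ} (hε : 0 < ε) (P : Measure Ω) :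
    ∃ C : ℝ, ∀ l : ℝ, 0 < l → ∀ X : Ω → Set Plane, IsPoissonProcess P l X →
      ∃ G : Ω → ℝ, Integrable G P ∧ (∀ ω, 0 ≤ G ω) ∧ ∫ ω, G ω ∂P ≤ C / l ^ 2 ∧
        ∀ᵐ ω ∂P, ∃ r : ℝ, 0 ≤ r ∧ cellAround K (X ω) ⊆ r • K ∧ (r ≤ 1 + ε ∨ r ^ 2 ≤ G ω) := by
  obtain ⟨Z, hZ, hcov⟩ := exists_finset_empty_closedBall hc hk h0 hε
  set b : Plane × ℝ → ℝ := fun p => 2 / (p.2 ^ 2 * volume.real (Metric.ball (0 : Plane) 1)) ^ 2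
  set B : ℝ := ∑ p ∈ Z, b p with hB
  have hb0 : ∀ p, 0 ≤ b p := fun p => by positivity
  have hB0 : 0 ≤ B := Finset.sum_nonneg fun p _ => hb0 p
  have hsum : Summable fun j : ℕ => 1 / ((j : ℝ) + 1) ^ 2 := by
    have := (summable_nat_add_iff 1).2 (Real.summable_one_div_nat_pow.2 one_lt_two)
    simpa using this
  set C : ℝ := 4 * (1 + ε) ^ 2 * B * ∑' j : ℕ, 1 / ((j : ℝ) + 1) ^ 2 with hC
  refine ⟨C, fun l hl X hX => ?_⟩
  set E : ℕ → Set Ω := fun j =>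
    {ω | ∃ p ∈ Z, X ω ∩ Metric.closedBall (((j : ℝ) + 1) • p.1) (((j : ℝ) + 1) * p.2) = ∅} with hE
  have hEU : ∀ j, E j = ⋃ p ∈ Z,
      {ω | X ω ∩ Metric.closedBall (((j : ℝ) + 1) • p.1) (((j : ℝ) + 1) * p.2) = ∅} := fun j => by
    ext; simp [hE]
  have hEm : ∀ j, MeasurableSet (E j) := fun j => by
    rw [hEU]
    exact Finset.measurableSet_biUnion _ fun p _ =>
      hX.measurableSet_inter_eq_empty measurableSet_closedBall Metric.isBounded_closedBall
  have hEP : ∀ j, P (E j) ≤ ENNReal.ofReal (B / (l ^ 2 * ((j : ℝ) + 1) ^ 4)) := fun j => by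
    rw [hEU, hB, Finset.sum_div, ENNReal.ofReal_sum_of_nonneg fun p _ => by
      have := hb0 p; positivity]
    exact (measure_biUnion_finset_le _ _).trans (Finset.sum_le_sum fun p hp =>
      hX.prob_closedBall_le hl (by positivity) p (hZ p hp))
  -- Shifted by one: if `j ≥ 1` is the first failure, then `E (j - 1)` holds and `a (j - 1)` is
  -- exactly `r ^ 2`.
  set a : ℕ → ℝ := fun j => ((j : ℝ) + 2) ^ 2 * (1 + ε) ^ 2
  set g : Ω → ENNReal := fun ω => ∑' j, (E j).indicator (fun _ => ENNReal.ofReal (a j)) ω with hg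
  have hgm : Measurable g := Measurable.tsum fun j => measurable_const.indicator (hEm j)
  have hgint : ∫⁻ ω, g ω ∂P ≤ ENNReal.ofReal (C / l ^ 2) := by
    rw [hg, lintegral_tsum fun j => (measurable_const.indicator (hEm j)).aemeasurable]
    simp only [lintegral_indicator_const (hEm _)]
    have hs : Summable fun j : ℕ => 4 * (1 + ε) ^ 2 * B / l ^ 2 * (1 / ((j : ℝ) + 1) ^ 2) :=
      hsum.mul_left _
    have hCl : C / l ^ 2 = ∑' j : ℕ, 4 * (1 + ε) ^ 2 * B / l ^ 2 * (1 / ((j : ℝ) + 1) ^ 2) := by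
      rw [tsum_mul_left, hC]; ring
    rw [hCl, ENNReal.ofReal_tsum_of_nonneg (fun j => by positivity) hs]
    refine ENNReal.tsum_le_tsum fun j => ?_
    calc ENNReal.ofReal (a j) * P (E j)
        ≤ ENNReal.ofReal (a j) * ENNReal.ofReal (B / (l ^ 2 * ((j : ℝ) + 1) ^ 4)) := by
          gcongr; exact hEP j
      _ = ENNReal.ofReal (a j * (B / (l ^ 2 * ((j : ℝ) + 1) ^ 4))) :=
          (ENNReal.ofReal_mul (by positivity)).symm
      _ ≤ _ := by
          refine ENNReal.ofReal_le_ofReal ?_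
          have h1 : a j ≤ 4 * ((j : ℝ) + 1) ^ 2 * (1 + ε) ^ 2 := by
            refine mul_le_mul_of_nonneg_right ?_ (sq_nonneg _)
            have : (0 : ℝ) ≤ j := Nat.cast_nonneg j
            nlinarith
          calc a j * (B / (l ^ 2 * ((j : ℝ) + 1) ^ 4))
              ≤ 4 * ((j : ℝ) + 1) ^ 2 * (1 + ε) ^ 2 * (B / (l ^ 2 * ((j : ℝ) + 1) ^ 4)) := by
                gcongr
            _ = _ := by field_simp
  have hgfin : ∫⁻ ω, g ω ∂P ≠ ⊤ := (hgint.trans_lt ENNReal.ofReal_lt_top).ne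
  have hae := ae_lt_top hgm hgfin
  refine ⟨fun ω => (g ω).toReal, integrable_toReal_of_lintegral_ne_top hgm.aemeasurable hgfin,
    fun ω => ENNReal.toReal_nonneg, ?_, ?_⟩
  · rw [integral_toReal hgm.aemeasurable hae]
    refine ENNReal.toReal_le_of_le_ofReal ?_ hgint
    have : 0 ≤ ∑' j : ℕ, 1 / ((j : ℝ) + 1) ^ 2 := tsum_nonneg fun j => by positivity
    positivity
  · filter_upwards [hae] with ω hω
    have hterm : ∀ j, ω ∈ E j → ENNReal.ofReal (a j) ≤ g ω := fun j hj => by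
      have := ENNReal.le_tsum (f := fun j => (E j).indicator (fun _ => ENNReal.ofReal (a j)) ω) j
      rwa [Set.indicator_of_mem hj] at this
    have hterm' : ∀ j, ω ∈ E j → a j ≤ (g ω).toReal := fun j hj =>
      (ENNReal.ofReal_le_iff_le_toReal hω.ne).1 (hterm j hj)
    have hex : ∃ j, ω ∉ E j := by
      by_contra! hall
      obtain ⟨j, hj⟩ := exists_nat_gt (g ω).toReal
      have h1 := hterm' j (hall j)
      have h2 : (j : ℝ) ≤ a j := by
        have : (0 : ℝ) ≤ j := Nat.cast_nonneg j
        have h3 : (j : ℝ) ≤ ((j : ℝ) + 2) ^ 2 := by nlinarith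
        have h4 : (1 : ℝ) ≤ (1 + ε) ^ 2 := by nlinarith
        calc (j : ℝ) ≤ ((j : ℝ) + 2) ^ 2 := h3
          _ ≤ a j := le_mul_of_one_le_right (by positivity) h4
      linarith
    classical
    have hnot := Nat.find_spec hex
    have hmin : ∀ m < Nat.find hex, ω ∈ E m := fun m hm => not_not.1 (Nat.find_min hex hm)
    set j := Nat.find hex
    refine ⟨((j : ℝ) + 1) * (1 + ε), by positivity, ?_, ?_⟩
    · by_contra hsub
      exact hnot (hcov ((j : ℝ) + 1) (by linarith [(Nat.cast_nonneg j : (0 : ℝ) ≤ j)]) _ hsub)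
    · rcases Nat.eq_zero_or_eq_succ_pred j with h | h
      · left; rw [h]; simp
      · right
        refine le_of_eq_of_le ?_ (hterm' (j - 1) (hmin (j - 1) (by omega)))
        have : (j : ℝ) = ((j - 1 : ℕ) : ℝ) + 1 := by
          rw [← Nat.cast_succ]; exact congrArg _ h
        rw [this]
        simp only [a]
        rw [mul_pow]
        ring

end Poisson

/-! ### The expected number of vertices -/

theorem zero_mem_two_smul_flower {K : Set Plane} (h0 : (0 : Plane) ∈ K) :
    (0 : Plane) ∈ (2 : ℝ) • flower 0 K :=
  mem_two_smul_flower.2 ⟨0, h0, by simp⟩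

theorem convex_cellAround (K χ : Set Plane) : Convex ℝ (cellAround K χ) := by
  rw [cellAround_eq]; exact convex_emptyCell _

theorem isClosed_cellAround (K χ : Set Plane) : IsClosed (cellAround K χ) := by
  rw [cellAround_eq]; exact isClosed_emptyCell _

theorem subset_cellAround (K χ : Set Plane) : K ⊆ cellAround K χ := by
  rw [cellAround_eq]; exact subset_emptyCell K χ

theorem isCompact_cellAround {K χ : Set Plane} (hb : Bornology.IsBounded (cellAround K χ)) :
    IsCompact (cellAround K χ) :=
  Metric.isCompact_of_isClosed_isBounded (isClosed_cellAround K χ) hb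

theorem vertices_cellAround {K χ : Set Plane} (h0 : (0 : Plane) ∈ interior K)
    (hχ : ∀ B, Bornology.IsBounded B → (χ ∩ B).Finite)
    (hb : Bornology.IsBounded (cellAround K χ)) :
    1 ≤ numVertices (cellAround K χ) ∧
      Measure.count {x | ∃ k, χ ∩ testSet K (TopologicalSpace.denseSeq Plane k) = {x}} =
        numVertices (cellAround K χ) := by
  have hne := (isCompact_cellAround hb).extremePoints_nonempty
    ⟨0, subset_cellAround K χ (interior_subset h0)⟩
  have h0' : (0 : Plane) ∈ interior (cellAround K χ) :=
    interior_mono (subset_cellAround K χ) h0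
  rw [numVertices]
  simp only [inter_testSet]
  rw [cellAround_eq] at hb h0' hne ⊢
  set N := χ ∩ ((2 : ℝ) • flower 0 K)ᶜ
  obtain ⟨h1, h2, h3⟩ := extremePoints_emptyCell
    (fun B hB => (hχ B hB).subset (Set.inter_subset_inter_left _ Set.inter_subset_left))
    (fun h : (0 : Plane) ∈ N => h.2 (zero_mem_two_smul_flower (interior_subset h0))) hb
  refine ⟨(Set.ncard_pos h1).2 hne, ?_⟩
  rw [← neighbours_eq h0', Measure.count_apply h2.measurableSet, h3, ← h2.cast_ncard_eq]
  rfl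

theorem volume_two_smul_flower {L : Set Plane} (hL : Bornology.IsBounded L) :
    volume ((2 : ℝ) • flower 0 L) = ENNReal.ofReal (4 * area (flower 0 L)) := by
  obtain ⟨R, hR⟩ := hL.exists_norm_le
  have hfin : volume (flower 0 L) ≠ ⊤ :=
    (Metric.isBounded_closedBall.subset (flower_subset_closedBall hR)).measure_lt_top.ne
  rw [Measure.addHaar_smul, area, Measure.real, ENNReal.ofReal_mul (by norm_num),
    ENNReal.ofReal_toReal hfin, finrank_euclideanSpace, Fintype.card_fin]
  norm_num

theorem area_nonneg (L : Set Plane) : 0 ≤ area L := measureReal_nonneg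

theorem area_flower_mono {K L : Set Plane} (hL : Bornology.IsBounded L) (h : K ⊆ L) :
    area (flower 0 K) ≤ area (flower 0 L) := by
  obtain ⟨R, hR⟩ := hL.exists_norm_le
  exact measureReal_mono (flower_mono h)
    (Metric.isBounded_closedBall.subset (flower_subset_closedBall hR)).measure_lt_top.ne

theorem volume_new_nuclei {K χ : Set Plane} (hk : IsCompact K) (h0 : (0 : Plane) ∈ interior K)
    (hb : Bornology.IsBounded (cellAround K χ)) :
    volume {x | ∃ k, x ∈ testSet K (TopologicalSpace.denseSeq Plane k) ∧
        χ ∩ testSet K (TopologicalSpace.denseSeq Plane k) = ∅} =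
      ENNReal.ofReal (4 * (area (flower 0 (cellAround K χ)) - area (flower 0 K))) := by
  have hsub := subset_cellAround K χ
  have h1 : {x | ∃ k, x ∈ testSet K (TopologicalSpace.denseSeq Plane k) ∧
        χ ∩ testSet K (TopologicalSpace.denseSeq Plane k) = ∅} =
      {x | ∃ k, TopologicalSpace.denseSeq Plane k ∈ cellAround K χ ∧
        x ∈ Metric.ball (TopologicalSpace.denseSeq Plane k) ‖TopologicalSpace.denseSeq Plane k‖} \
        ((2 : ℝ) • flower 0 K) := by
    ext x
    simp only [Set.mem_ofPred_eq, Set.mem_sdiff, mem_cellAround]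
    constructor
    · rintro ⟨k, hx, hk⟩
      exact ⟨⟨k, hk, hx.1⟩, hx.2⟩
    · rintro ⟨⟨k, hk, hx⟩, hx'⟩
      exact ⟨k, ⟨hx, hx'⟩, hk⟩
  have hF := (isClosed_two_smul_flower hk).measurableSet
  have hsub2 : (2 : ℝ) • flower 0 K ⊆ (2 : ℝ) • flower 0 (cellAround K χ) :=
    Set.smul_set_mono (flower_mono hsub)
  have hae := (two_smul_flower_ae_eq (convex_cellAround K χ) (interior_mono hsub h0) hb).diff
    (ae_eq_refl ((2 : ℝ) • flower 0 K : Set Plane))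
  rw [h1, measure_congr hae,
    measure_sdiff hsub2 hF.nullMeasurableSet (by
      rw [volume_two_smul_flower hk.isBounded]; exact ENNReal.ofReal_ne_top),
    volume_two_smul_flower hb, volume_two_smul_flower hk.isBounded, mul_sub,
    ENNReal.ofReal_sub _ (mul_nonneg zero_le_four (area_nonneg _))]

section Poisson

variable {Ω : Type*} [MeasurableSpace Ω] {P : Measure Ω} {l : ℝ} {X : Ω → Set Plane}

/-- The cell is contained in a random multiple of `K` whose square is integrable. -/
theorem IsPoissonProcess.exists_integrable_bound [IsProbabilityMeasure P]
    (hX : IsPoissonProcess P l X) (hl : 0 < l)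
    {K : Set Plane} (hc : Convex ℝ K) (hk : IsCompact K) (h0 : (0 : Plane) ∈ interior K) :
    ∃ G : Ω → ℝ, Integrable G P ∧ (∀ ω, 1 ≤ G ω) ∧
      ∀ᵐ ω ∂P, ∃ r : ℝ, 0 ≤ r ∧ cellAround K (X ω) ⊆ r • K ∧ r ^ 2 ≤ G ω := by
  obtain ⟨C, hC⟩ := exists_envelope hc hk h0 one_pos P
  obtain ⟨G, hGi, hG0, -, hG⟩ := hC l hl X hX
  refine ⟨fun ω => 4 + G ω, (integrable_const _).add hGi, fun ω => by linarith [hG0 ω], ?_⟩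
  filter_upwards [hG] with ω ⟨r, hr, hsub, h⟩
  refine ⟨r, hr, hsub, ?_⟩
  rcases h with h | h
  · nlinarith [hG0 ω]
  · linarith

/-- Measurability of the flower area and integrability of the vertex number are both read off from
the Mecke formula, whose area side is finite. Unbounded cells form a null set. -/
theorem IsPoissonProcess.vertices_formula [IsProbabilityMeasure P]
    (hX : IsPoissonProcess P l X) (hl : 0 < l)
    {K : Set Plane} (hc : Convex ℝ K) (hk : IsCompact K) (h0 : (0 : Plane) ∈ interior K) :
    Integrable (fun ω => (numVertices (cellAround K (X ω)) : ℝ)) P ∧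
      Integrable (fun ω => area (flower 0 (cellAround K (X ω)))) P ∧
      1 ≤ ∫ ω, (numVertices (cellAround K (X ω)) : ℝ) ∂P ∧
      ∫ ω, (numVertices (cellAround K (X ω)) : ℝ) ∂P =
        4 * l * (∫ ω, area (flower 0 (cellAround K (X ω))) ∂P - area (flower 0 K)) := by
  obtain ⟨G, hGi, hG1, hG⟩ := hX.exists_integrable_bound hl hc hk h0
  obtain ⟨hm1, hm2, hmecke⟩ := hX.mecke hl
    (W := fun k => testSet K (TopologicalSpace.denseSeq Plane k))
    (fun k => measurableSet_testSet hk _) fun k => isBounded_testSet K _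
  have hbdd : ∀ᵐ ω ∂P, Bornology.IsBounded (cellAround K (X ω)) := by
    filter_upwards [hG] with ω ⟨r, _, hsub, _⟩
    exact (hk.isBounded.smul₀ r).subset hsub
  have hN := hbdd.mono fun ω hω => vertices_cellAround h0 (hX.locallyFinite ω) hω
  have hA := hbdd.mono fun ω hω => volume_new_nuclei (χ := X ω) hk h0 hω
  have hAK := hbdd.mono fun ω hω => area_flower_mono hω (subset_cellAround K (X ω))
  set V : Ω → ENNReal := fun ω =>
    volume {x | ∃ k, x ∈ testSet K (TopologicalSpace.denseSeq Plane k) ∧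
        X ω ∩ testSet K (TopologicalSpace.denseSeq Plane k) = ∅}
  set M : Ω → ENNReal := fun ω =>
    Measure.count {x | ∃ k, X ω ∩ testSet K (TopologicalSpace.denseSeq Plane k) = {x}}
  have hAeq : (fun ω => (V ω).toReal / 4 + area (flower 0 K)) =ᵐ[P]
      fun ω => area (flower 0 (cellAround K (X ω))) := by
    filter_upwards [hA, hAK] with ω h h'
    rw [show V ω = _ from h, ENNReal.toReal_ofReal (by linarith)]
    ring
  have hAm : AEStronglyMeasurable (fun ω => area (flower 0 (cellAround K (X ω)))) P :=
    (((hm2.ennreal_toReal).div_const 4).add_const _).aestronglyMeasurable.congr hAeq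
  have hAi : Integrable (fun ω => area (flower 0 (cellAround K (X ω)))) P := by
    obtain ⟨R, hR⟩ := hk.isBounded.exists_norm_le
    refine Integrable.mono' (hGi.mul_const (R ^ 2 * volume.real (Metric.ball (0 : Plane) 1))) hAm ?_
    filter_upwards [hG] with ω ⟨r, hr, hsub, hrG⟩
    have hR0 : 0 ≤ R := (norm_nonneg _).trans (hR 0 (interior_subset h0))
    have hball : flower 0 (cellAround K (X ω)) ⊆ Metric.closedBall 0 (r * R) := by
      refine flower_subset_closedBall fun s hs => ?_
      obtain ⟨y, hy, rfl⟩ := hsub hs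
      simp only [norm_smul, Real.norm_of_nonneg hr]
      exact mul_le_mul_of_nonneg_left (hR y hy) hr
    rw [Real.norm_of_nonneg (area_nonneg _)]
    calc area (flower 0 (cellAround K (X ω))) ≤ volume.real (Metric.closedBall (0 : Plane) (r * R)) :=
          measureReal_mono hball measure_closedBall_lt_top.ne
      _ = r ^ 2 * (R ^ 2 * volume.real (Metric.ball (0 : Plane) 1)) := by
          rw [Measure.addHaar_real_closedBall _ _ (by positivity), finrank_euclideanSpace,
            Fintype.card_fin]
          ring
      _ ≤ G ω * (R ^ 2 * volume.real (Metric.ball (0 : Plane) 1)) := by gcongr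
  have hV : ∫⁻ ω, V ω ∂P =
      ENNReal.ofReal (4 * (∫ ω, area (flower 0 (cellAround K (X ω))) ∂P - area (flower 0 K))) := by
    rw [lintegral_congr_ae hA, ← ofReal_integral_eq_lintegral_ofReal]
    · rw [integral_const_mul, integral_sub hAi (integrable_const _)]
      simp
    · exact (hAi.sub (integrable_const _)).const_mul 4
    · filter_upwards [hAK] with ω h
      show (0 : ℝ) ≤ _
      linarith
  have hAE : 0 ≤ ∫ ω, area (flower 0 (cellAround K (X ω))) ∂P - area (flower 0 K) := by
    have : area (flower 0 K) = ∫ _ω, area (flower 0 K) ∂P := by simp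
    rw [sub_nonneg, this]
    exact integral_mono_ae (integrable_const _) hAi hAK
  rw [hV, ← ENNReal.ofReal_mul hl.le] at hmecke
  have hMeq : (fun ω => (M ω).toReal) =ᵐ[P]
      fun ω => (numVertices (cellAround K (X ω)) : ℝ) := by
    filter_upwards [hN] with ω h
    rw [show M ω = _ from h.2]
    simp
  have hMi : Integrable (fun ω => (M ω).toReal) P :=
    integrable_toReal_of_lintegral_ne_top hm1.aemeasurable (hmecke ▸ ENNReal.ofReal_ne_top)
  have hNi : Integrable (fun ω => (numVertices (cellAround K (X ω)) : ℝ)) P := hMi.congr hMeq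
  refine ⟨hNi, hAi, ?_, ?_⟩
  · have : (1 : ℝ) = ∫ _ω, 1 ∂P := by simp
    rw [this]
    refine integral_mono_ae (integrable_const _) hNi ?_
    filter_upwards [hN] with ω h
    exact_mod_cast h.1
  · rw [← integral_congr_ae hMeq, integral_toReal hm1.aemeasurable, hmecke,
      ENNReal.toReal_ofReal (mul_nonneg hl.le (mul_nonneg zero_le_four hAE))]
    · ring
    · filter_upwards [hN] with ω h
      rw [show M ω = _ from h.2]
      simp

end Poisson

/-! ### Mean support function and asymptotics -/

theorem ofReal_supportFun_eq_iSup {C : Set Plane} (hC : Convex ℝ C)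
    (h0 : (0 : Plane) ∈ interior C) (hb : Bornology.IsBounded C) (z : Plane) :
    ENNReal.ofReal (supportFun 0 C z) = ⨆ k, C.indicator (fun y => ENNReal.ofReal (inner ℝ y z))
      (TopologicalSpace.denseSeq Plane k) := by
  refine le_antisymm (le_of_forall_lt fun c hc => ?_) (iSup_le fun k => ?_)
  · have hct : c ≠ ⊤ := (hc.trans ENNReal.ofReal_lt_top).ne
    have hc' := (ENNReal.lt_ofReal_iff_toReal_lt hct).1 hc
    rw [supportFun_eq] at hc'
    obtain ⟨_, ⟨y, hy, rfl⟩, hcy⟩ := exists_lt_of_lt_csSup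
      (Set.Nonempty.image _ ⟨0, interior_subset h0⟩) hc'
    obtain ⟨k, hk, hck⟩ := exists_denseSeq_mem hC h0 (U := {y | c.toReal < inner ℝ y z})
      (isOpen_lt continuous_const (by fun_prop)) ⟨y, hy, hcy⟩
    refine lt_of_lt_of_le ?_ (le_iSup _ k)
    rw [Set.indicator_of_mem hk]
    exact (ENNReal.lt_ofReal_iff_toReal_lt hct).2 hck
  · by_cases hk : TopologicalSpace.denseSeq Plane k ∈ C
    · rw [Set.indicator_of_mem hk]
      exact ENNReal.ofReal_le_ofReal (inner_le_supportFun hb hk z)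
    · rw [Set.indicator_of_notMem hk]
      exact zero_le

section Poisson

variable {Ω : Type*} [MeasurableSpace Ω] {P : Measure Ω} {l : ℝ} {X : Ω → Set Plane}

/-- Joint measurability in `(θ, ω)` for Fubini: the support function is a countable supremum over
dense points, and membership of such a point in the cell is an empty-test-set event. -/
theorem IsPoissonProcess.exists_measurable_supportFun (hX : IsPoissonProcess P l X)
    {K : Set Plane} (hk : IsCompact K) (h0 : (0 : Plane) ∈ interior K) :
    ∃ q : ℝ × Ω → ℝ, Measurable q ∧ ∀ ω, Bornology.IsBounded (cellAround K (X ω)) → ∀ θ,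
      q (θ, ω) = supportFun 0 (cellAround K (X ω)) (unitVec θ) := by
  refine ⟨fun z => (⨆ k, (cellAround K (X z.2)).indicator
    (fun y => ENNReal.ofReal (inner ℝ y (unitVec z.1)))
      (TopologicalSpace.denseSeq Plane k)).toReal, ?_, fun ω hω θ => ?_⟩
  · refine (Measurable.iSup fun k => ?_).ennreal_toReal
    have hm := hX.measurableSet_inter_eq_empty
      (measurableSet_testSet hk (TopologicalSpace.denseSeq Plane k)) (isBounded_testSet K _)
    have : (fun z : ℝ × Ω => (cellAround K (X z.2)).indicator
        (fun y => ENNReal.ofReal (inner ℝ y (unitVec z.1)))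
        (TopologicalSpace.denseSeq Plane k)) =
      (Prod.snd ⁻¹' {ω | X ω ∩ testSet K (TopologicalSpace.denseSeq Plane k) = ∅}).indicator
        fun z => ENNReal.ofReal (inner ℝ (TopologicalSpace.denseSeq Plane k) (unitVec z.1)) := by
      ext z
      simp only [Set.indicator, mem_cellAround]
      rfl
    rw [this]
    refine Measurable.indicator (ENNReal.measurable_ofReal.comp ?_) (measurable_snd hm)
    have : Continuous fun θ => (inner ℝ (TopologicalSpace.denseSeq Plane k) (unitVec θ) : ℝ) :=
      continuous_const.inner continuous_unitVec
    exact this.measurable.comp measurable_fst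
  · have hsub := subset_cellAround K (X ω)
    simp only
    rw [← ofReal_supportFun_eq_iSup (convex_cellAround K (X ω)) (interior_mono hsub h0) hω,
      ENNReal.toReal_ofReal (supportFun_nonneg hω (hsub (interior_subset h0)) _)]

/-- Expand `(p + d)² / 2 - p² / 2 = p d + d² / 2` and let `S` be the integral of `d²`. Pointwise, `r
≤ 1 + ε` gives `d ≤ ε p`, and otherwise `d² ≤ M² r² ≤ M² G`. -/
theorem IsPoissonProcess.vertices_expansion [IsProbabilityMeasure P]
    (hX : IsPoissonProcess P l X) (hl : 0 < l)
    {K : Set Plane} (hc : Convex ℝ K) (hk : IsCompact K) (h0 : (0 : Plane) ∈ interior K)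
    {M : ℝ} (hM : ∀ s ∈ K, ‖s‖ ≤ M) :
    (∀ θ : ℝ, Integrable (fun ω => supportFun 0 (cellAround K (X ω)) (unitVec θ) -
      supportFun 0 K (unitVec θ)) P) ∧
    IntervalIntegrable (fun θ => supportFun 0 K (unitVec θ) *
      ∫ ω, (supportFun 0 (cellAround K (X ω)) (unitVec θ) - supportFun 0 K (unitVec θ)) ∂P)
      volume 0 (2 * Real.pi) ∧
    ∃ S : ℝ, 0 ≤ S ∧
      ∫ ω, (numVertices (cellAround K (X ω)) : ℝ) ∂P =
        4 * l * (∫ θ in (0 : ℝ)..(2 * Real.pi), supportFun 0 K (unitVec θ) *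
          ∫ ω, (supportFun 0 (cellAround K (X ω)) (unitVec θ) -
            supportFun 0 K (unitVec θ)) ∂P) + 2 * l * S ∧
      ∀ ε : ℝ, 0 < ε → ∀ G : Ω → ℝ, Integrable G P → (∀ ω, 0 ≤ G ω) →
        (∀ᵐ ω ∂P, ∃ r : ℝ, 0 ≤ r ∧ cellAround K (X ω) ⊆ r • K ∧ (r ≤ 1 + ε ∨ r ^ 2 ≤ G ω)) →
        S ≤ ε * (∫ θ in (0 : ℝ)..(2 * Real.pi), supportFun 0 K (unitVec θ) *
          ∫ ω, (supportFun 0 (cellAround K (X ω)) (unitVec θ) -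
            supportFun 0 K (unitVec θ)) ∂P) + 2 * Real.pi * M ^ 2 * ∫ ω, G ω ∂P := by
  have hpi := Real.pi_pos
  have hK0 : (0 : Plane) ∈ K := interior_subset h0
  obtain ⟨G, hGi, hG1, hG⟩ := hX.exists_integrable_bound hl hc hk h0
  obtain ⟨q, hqm, hq⟩ := hX.exists_measurable_supportFun hk h0
  obtain ⟨-, hAi, -, hformula⟩ := hX.vertices_formula hl hc hk h0
  set p : ℝ → ℝ := fun θ => supportFun 0 K (unitVec θ) with hp
  have hpc : Continuous p := (continuous_supportFun hk).comp continuous_unitVec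
  have hp0 : ∀ θ, 0 ≤ p θ := fun θ => supportFun_nonneg hk.isBounded hK0 _
  have hpM : ∀ θ, p θ ≤ M := fun θ => supportFun_le ⟨0, hK0⟩ fun y hy => by
    have := real_inner_le_norm y (unitVec θ)
    rw [norm_unitVec, mul_one] at this
    exact this.trans (hM y hy)
  have hM0 : 0 ≤ M := (hp0 0).trans (hpM 0)
  set d : ℝ × Ω → ℝ := fun z => q z - p z.1 with hd
  have hdm : Measurable d := hqm.sub (hpc.measurable.comp measurable_fst)
  have hbdd : ∀ᵐ ω ∂P, Bornology.IsBounded (cellAround K (X ω)) := by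
    filter_upwards [hG] with ω ⟨r, _, hsub, _⟩
    exact (hk.isBounded.smul₀ r).subset hsub
  have hcell : ∀ ω, Bornology.IsBounded (cellAround K (X ω)) → ∀ θ, 0 ≤ d (θ, ω) := by
    intro ω hω θ
    simp only [hd, hq ω hω θ]
    exact sub_nonneg.2 (supportFun_mono ⟨0, hK0⟩ hω (subset_cellAround K (X ω)) _)
  have hscale : ∀ ω r, 0 ≤ r → cellAround K (X ω) ⊆ r • K → ∀ θ, q (θ, ω) ≤ r * p θ := by
    intro ω r hr hsub θ
    rw [hq ω ((hk.isBounded.smul₀ r).subset hsub) θ]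
    exact supportFun_le_mul ⟨0, subset_cellAround K (X ω) hK0⟩ hk.isBounded hr hsub _
  have hbound : ∀ᵐ ω ∂P, ∀ θ, 0 ≤ d (θ, ω) ∧ d (θ, ω) ≤ M * G ω ∧ d (θ, ω) ^ 2 ≤ M ^ 2 * G ω := by
    filter_upwards [hG, hbdd] with ω ⟨r, hr, hsub, hrG⟩ hω θ
    have h1 := hcell ω hω θ
    have h2 := hscale ω r hr hsub θ
    have h3 : d (θ, ω) ≤ r * M := by
      have : r * p θ ≤ r * M := mul_le_mul_of_nonneg_left (hpM θ) hr
      simp only [hd]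
      linarith [hp0 θ]
    -- From `2 r ≤ r² + 1` and `1 ≤ G`.
    have h4 : r ≤ G ω := by nlinarith [hG1 ω, sq_nonneg (r - 1)]
    refine ⟨h1, h3.trans (by nlinarith), ?_⟩
    calc d (θ, ω) ^ 2 ≤ (r * M) ^ 2 := pow_le_pow_left₀ h1 h3 2
      _ = M ^ 2 * r ^ 2 := by ring
      _ ≤ M ^ 2 * G ω := by gcongr
  set ν : Measure ℝ := volume.restrict (Set.Ioc 0 (2 * Real.pi)) with hν
  have hpull : ∀ {Q : Ω → Prop}, (∀ᵐ ω ∂P, Q ω) → ∀ᵐ z ∂(ν.prod P), Q z.2 := fun h =>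
    Measure.quasiMeasurePreserving_snd.ae h
  have hGprod : Integrable (fun z : ℝ × Ω => G z.2) (ν.prod P) := hGi.comp_snd ν
  have hdi : Integrable d (ν.prod P) := by
    refine (hGprod.const_mul M).mono' hdm.aestronglyMeasurable ?_
    filter_upwards [hpull hbound] with z hz
    rw [Real.norm_of_nonneg (hz z.1).1]
    exact (hz z.1).2.1
  have hd2i : Integrable (fun z => d z ^ 2) (ν.prod P) := by
    refine (hGprod.const_mul (M ^ 2)).mono' (hdm.pow_const 2).aestronglyMeasurable ?_
    filter_upwards [hpull hbound] with z hz
    rw [Real.norm_of_nonneg (sq_nonneg _)]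
    exact (hz z.1).2.2
  have hpdi : Integrable (fun z : ℝ × Ω => p z.1 * d z) (ν.prod P) := by
    refine (hdi.norm.const_mul M).mono'
      ((hpc.measurable.comp measurable_fst).mul hdm).aestronglyMeasurable ?_
    refine Eventually.of_forall fun z => ?_
    rw [norm_mul, Real.norm_of_nonneg (hp0 z.1)]
    exact mul_le_mul_of_nonneg_right (hpM z.1) (norm_nonneg _)
  have hdeq : ∀ θ, (fun ω => d (θ, ω)) =ᵐ[P] fun ω =>
      supportFun 0 (cellAround K (X ω)) (unitVec θ) - supportFun 0 K (unitVec θ) := fun θ => by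
    filter_upwards [hbdd] with ω hω
    simp only [hd, hq ω hω θ, hp]
  have hdint : ∀ θ, ∫ ω, (supportFun 0 (cellAround K (X ω)) (unitVec θ) -
      supportFun 0 K (unitVec θ)) ∂P = ∫ ω, d (θ, ω) ∂P := fun θ =>
    (integral_congr_ae (hdeq θ)).symm
  simp only [hdint]
  have hD : ∫ θ in (0 : ℝ)..(2 * Real.pi), p θ * ∫ ω, d (θ, ω) ∂P =
      ∫ z, p z.1 * d z ∂(ν.prod P) := by
    rw [intervalIntegral.integral_of_le (by positivity), integral_prod _ hpdi]
    simp only [integral_const_mul, hν]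
  rw [hD]
  refine ⟨fun θ => ?_, ?_, ∫ z, d z ^ 2 ∂(ν.prod P), integral_nonneg fun z => sq_nonneg _, ?_, ?_⟩
  · refine Integrable.congr ?_ (hdeq θ)
    refine (hGi.const_mul M).mono' (hdm.comp measurable_prodMk_left).aestronglyMeasurable ?_
    filter_upwards [hbound] with ω h
    rw [Real.norm_of_nonneg (h θ).1]
    exact (h θ).2.1
  · rw [intervalIntegrable_iff_integrableOn_Ioc_of_le (by positivity)]
    have := hpdi.integral_prod_left
    simp only [integral_const_mul] at this
    exact this
  · have hsq : ∀ f : ℝ → ℝ, Continuous f →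
        IntervalIntegrable (fun θ => f θ ^ 2 / 2) volume 0 (2 * Real.pi) := fun f hf =>
      Continuous.intervalIntegrable (by fun_prop) _ _
    have harea : ∀ᵐ ω ∂P, area (flower 0 (cellAround K (X ω))) - area (flower 0 K) =
        ∫ θ, (p θ * d (θ, ω) + d (θ, ω) ^ 2 / 2) ∂ν := by
      filter_upwards [hbdd] with ω hω
      have hck := isCompact_cellAround hω
      have hcc : Continuous fun θ => supportFun 0 (cellAround K (X ω)) (unitVec θ) :=
        (continuous_supportFun hck).comp continuous_unitVec
      rw [area_flower hck (subset_cellAround K (X ω) hK0), area_flower hk hK0,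
        ← intervalIntegral.integral_sub
          (hsq _ hcc) (hsq (fun θ => supportFun 0 K (unitVec θ)) hpc),
        intervalIntegral.integral_of_le (by positivity)]
      refine integral_congr_ae (Eventually.of_forall fun θ => ?_)
      simp only [hd, hq ω hω θ]
      ring
    have hEA : ∫ ω, area (flower 0 (cellAround K (X ω))) ∂P - area (flower 0 K) =
        ∫ z, p z.1 * d z ∂(ν.prod P) + (∫ z, d z ^ 2 ∂(ν.prod P)) / 2 := by
      have h1 : ∫ ω, area (flower 0 (cellAround K (X ω))) ∂P - area (flower 0 K) =
          ∫ ω, (area (flower 0 (cellAround K (X ω))) - area (flower 0 K)) ∂P := by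
        rw [integral_sub hAi (integrable_const _)]; simp
      have h2 : Integrable (fun z : ℝ × Ω => p z.1 * d z + d z ^ 2 / 2) (ν.prod P) :=
        hpdi.add (hd2i.div_const 2)
      rw [h1, integral_congr_ae harea, ← integral_div, ← integral_add hpdi (hd2i.div_const 2),
        integral_prod_symm _ h2]
    rw [hformula, hEA]
    ring
  · intro ε hε H hHi hH0 hH
    have hle : ∀ᵐ z ∂(ν.prod P), d z ^ 2 ≤ ε * (p z.1 * d z) + M ^ 2 * H z.2 := by
      filter_upwards [hpull hbdd, hpull hH] with z hz ⟨r, hr, hsub, hrH⟩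
      have h1 : 0 ≤ d z := hcell z.2 hz z.1
      have h2 : q z ≤ r * p z.1 := hscale z.2 r hr hsub z.1
      have h3 := hp0 z.1
      have h4 : d z = q z - p z.1 := rfl
      rcases hrH with h | h
      · have h5 : d z ≤ ε * p z.1 := by nlinarith
        have h6 : 0 ≤ M ^ 2 * H z.2 := mul_nonneg (sq_nonneg _) (hH0 _)
        nlinarith
      · have h5 : d z ≤ r * M := by
          have : r * p z.1 ≤ r * M := mul_le_mul_of_nonneg_left (hpM z.1) hr
          linarith
        have h6 : 0 ≤ ε * (p z.1 * d z) := by positivity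
        have h7 : d z ^ 2 ≤ (r * M) ^ 2 := pow_le_pow_left₀ h1 h5 2
        have h8 : M ^ 2 * r ^ 2 ≤ M ^ 2 * H z.2 := mul_le_mul_of_nonneg_left h (sq_nonneg _)
        nlinarith
    have hHprod : Integrable (fun z : ℝ × Ω => H z.2) (ν.prod P) := hHi.comp_snd ν
    refine (integral_mono_ae hd2i ((hpdi.const_mul ε).add (hHprod.const_mul (M ^ 2))) hle).trans
      (le_of_eq ?_)
    have hHint : ∫ z, H z.2 ∂(ν.prod P) = 2 * Real.pi * ∫ ω, H ω ∂P := by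
      rw [integral_prod _ hHprod]
      simp [hν, Measure.real, hpi.le]
    simp only [Pi.add_apply]
    rw [integral_add (hpdi.const_mul ε) (hHprod.const_mul (M ^ 2)), integral_const_mul,
      integral_const_mul, hHint]
    ring

end Poisson

/-- With `E = l * D l` the ratio minus 1 is `l * S / (2 * E)`, while `l * S ≤ η * E + B / l`. So
only a positive lower bound on `E` is needed, and `1 ≤ N` supplies it. -/
theorem tendsto_one_of_expansion {N D : ℝ → ℝ} (hN : ∀ l, 0 < l → 1 ≤ N l) {M : ℝ}
    (h : ∀ ε : ℝ, 0 < ε → ∃ C : ℝ, ∀ l, 0 < l → ∃ S, 0 ≤ S ∧ N l = 4 * l * D l + 2 * l * S ∧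
      S ≤ ε * D l + M * (C / l ^ 2)) :
    Tendsto (fun l => N l / (4 * l * D l)) atTop (𝓝 1) := by
  rw [Metric.tendsto_atTop]
  intro ε hε
  set η := min ε 1 with hη
  have hη0 : 0 < η := lt_min hε one_pos
  have hη1 : η ≤ 1 := min_le_right _ _
  obtain ⟨C, hC⟩ := h η hη0
  set B := |M * C| with hB
  have hB0 : 0 ≤ B := abs_nonneg _
  -- `4 * B ≤ l` makes `B / l ≤ 1 / 4`, so `1 ≤ 4 E + 2 (η E + B / l)` with `η ≤ 1` forces `E ≥ 1 /
  -- 12`. Then `24 * B ≤ η * l` gives `B / l ≤ η / 24 ≤ η E / 2`, hence `l * S < 2 η E`.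
  refine ⟨max 1 (24 * B / η + 4 * B + 1), fun l hl => ?_⟩
  have hl1 : 1 ≤ l := (le_max_left _ _).trans hl
  have hl0 : 0 < l := by linarith
  have hl2 : 24 * B / η + 4 * B + 1 ≤ l := (le_max_right _ _).trans hl
  obtain ⟨S, hS0, hNS, hSle⟩ := hC l hl0
  have hdiv : 0 ≤ 24 * B / η := by positivity
  have hlB : 4 * B ≤ l := by linarith
  have hlB' : 24 * B ≤ η * l := by
    have : 24 * B / η ≤ l := by linarith
    rw [div_le_iff₀ hη0] at this
    linarith
  have hlS : l * S ≤ η * (l * D l) + B / l := by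
    have h1 : l * S ≤ l * (η * D l + M * (C / l ^ 2)) := mul_le_mul_of_nonneg_left hSle hl0.le
    have h2 : l * (η * D l + M * (C / l ^ 2)) = η * (l * D l) + M * C / l := by
      field_simp
    have h3 : M * C / l ≤ B / l := by gcongr; exact le_abs_self _
    linarith
  set E := l * D l with hE
  have hN1 := hN l hl0
  have hNE : N l = 4 * E + 2 * (l * S) := by rw [hNS, hE]; ring
  have hBl : B / l ≤ 1 / 4 := by rw [div_le_iff₀ hl0]; linarith
  have hBl' : 24 * (B / l) ≤ η := by
    rw [← mul_div_assoc, div_le_iff₀ hl0]; exact hlB'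
  have hE0 : 1 / 12 ≤ E := by
    by_contra! hlt
    rcases le_or_gt E 0 with h0 | h0
    · have : η * E ≤ 0 := mul_nonpos_of_nonneg_of_nonpos hη0.le h0
      linarith
    · have : η * E ≤ E := mul_le_of_le_one_left h0.le hη1
      linarith
  have hE' : 0 < E := by linarith
  have hden : 4 * l * D l = 4 * E := by rw [hE]; ring
  have hlS0 : 0 ≤ l * S := mul_nonneg hl0.le hS0
  rw [hden, Real.dist_eq, hNE]
  have hrat : (4 * E + 2 * (l * S)) / (4 * E) - 1 = l * S / (2 * E) := by field_simp; ring
  rw [hrat, abs_of_nonneg (by positivity), div_lt_iff₀ (by positivity)]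
  have h5 : η * (1 / 12) ≤ η * E := mul_le_mul_of_nonneg_left hE0 hη0.le
  have h6 : η * E ≤ ε * E := mul_le_mul_of_nonneg_right (min_le_left _ _) hE'.le
  have h7 : 0 < η * E := by positivity
  linarith

end PoissonVoronoi

end

/-! ### The exact formula and the asymptotic equivalence -/

theorem mainTheorem6 (K : ConvexBody PoissonVoronoi.Plane)
    (hK : (0 : PoissonVoronoi.Plane) ∈ interior (K : Set PoissonVoronoi.Plane))
    {Ω : Type*} [MeasurableSpace Ω] (P : Measure Ω) [IsProbabilityMeasure P] :
    (∀ l : ℝ, 0 < l → ∀ X : Ω → Set PoissonVoronoi.Plane,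
      PoissonVoronoi.IsPoissonProcess P l X →
        Integrable (fun ω =>
          (PoissonVoronoi.numVertices (PoissonVoronoi.cellAround K (X ω)) : ℝ)) P ∧
        Integrable (fun ω =>
          PoissonVoronoi.area
            (PoissonVoronoi.flower 0 (PoissonVoronoi.cellAround K (X ω)))) P ∧
        ∫ ω, (PoissonVoronoi.numVertices (PoissonVoronoi.cellAround K (X ω)) : ℝ) ∂P =
          4 * l *
            ((∫ ω, PoissonVoronoi.area
                (PoissonVoronoi.flower 0 (PoissonVoronoi.cellAround K (X ω))) ∂P) -
              PoissonVoronoi.area (PoissonVoronoi.flower 0 K))) ∧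
    (∀ X : ℝ → Ω → Set PoissonVoronoi.Plane,
      (∀ l : ℝ, 0 < l → PoissonVoronoi.IsPoissonProcess P l (X l)) →
        (∀ l : ℝ, 0 < l →
          (∀ θ : ℝ, Integrable (fun ω =>
            PoissonVoronoi.supportFun 0 (PoissonVoronoi.cellAround K (X l ω))
                (PoissonVoronoi.unitVec θ) -
              PoissonVoronoi.supportFun 0 K (PoissonVoronoi.unitVec θ)) P) ∧
          IntervalIntegrable (fun θ =>
            PoissonVoronoi.supportFun 0 K (PoissonVoronoi.unitVec θ) *
              ∫ ω, (PoissonVoronoi.supportFun 0 (PoissonVoronoi.cellAround K (X l ω))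
                  (PoissonVoronoi.unitVec θ) -
                PoissonVoronoi.supportFun 0 K (PoissonVoronoi.unitVec θ)) ∂P)
            volume 0 (2 * Real.pi)) ∧
        Tendsto (fun l : ℝ =>
          (∫ ω, (PoissonVoronoi.numVertices (PoissonVoronoi.cellAround K (X l ω)) : ℝ) ∂P) /
            (4 * l * ∫ θ in (0 : ℝ)..(2 * Real.pi),
              PoissonVoronoi.supportFun 0 K (PoissonVoronoi.unitVec θ) *
                ∫ ω, (PoissonVoronoi.supportFun 0 (PoissonVoronoi.cellAround K (X l ω))
                    (PoissonVoronoi.unitVec θ) -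
                  PoissonVoronoi.supportFun 0 K (PoissonVoronoi.unitVec θ)) ∂P))
          atTop (𝓝 1)) := by
  obtain ⟨M, hM⟩ := K.isCompact.isBounded.exists_norm_le
  refine ⟨fun l hl X hX => ?_, fun X hX => ⟨fun l hl => ?_, ?_⟩⟩
  · obtain ⟨h1, h2, -, h3⟩ := hX.vertices_formula hl K.convex K.isCompact hK
    exact ⟨h1, h2, h3⟩
  · obtain ⟨h1, h2, -⟩ := (hX l hl).vertices_expansion hl K.convex K.isCompact hK hM
    exact ⟨h1, h2⟩
  · refine PoissonVoronoi.tendsto_one_of_expansion (M := 2 * Real.pi * M ^ 2)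
      (fun l hl => ((hX l hl).vertices_formula hl K.convex K.isCompact hK).2.2.1) fun ε hε => ?_
    obtain ⟨C, hC⟩ := PoissonVoronoi.exists_envelope K.convex K.isCompact hK hε P
    refine ⟨C, fun l hl => ?_⟩
    obtain ⟨G, hGi, hG0, hGC, hG⟩ := hC l hl (X l) (hX l hl)
    obtain ⟨-, -, S, hS0, hS, hSle⟩ :=
      (hX l hl).vertices_expansion hl K.convex K.isCompact hK hM
    refine ⟨S, hS0, hS, (hSle ε hε G hGi hG0 hG).trans ?_⟩
    gcongr
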